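/- Conventions. For a real random variable $X$ put $\rho_+(X)=\sup\{s\in\mathbb R: E|X|^s<\infty\}$ and $\rho_-(X)=\inf\{s\in\mathbb R: E|X|^s<\infty\}$ (with $0^s=\infty$ for $s<0$). We say that $|X|$ has moments of Gamma type on a strip $a<\Re s<b$ if there $$E|X|^s = C D^s\,\frac{\prod_{j=1}^J\Gamma(a_js+b_j)}{\prod_{k=1}^K\Gamma(a'_ks+b'_k)}$$ with real constants $C$, $D>0$, $a_j,a'_k\ne0$, $b_j,b'_k$, the integral converging absolutely and no Gamma factor having a pole in the strip; to such an expression belong the parameters $\gamma=\sum|a_j|-\sum|a'_k|$, $\gamma'=\sum a_j-\sum a'_k$, $\delta=\sum b_j-\sum b'_k-\frac{J-K}2$, $\kappa=\sum a_j\log|a_j|-\sum a'_k\log|a'_k|+\log D$, $C_1=|C|(2\pi)^{(J-K)/2}\prod|a_j|^{b_j-1/2}\big/\prod|a'_k|^{b'_k-1/2}$. For $0<\alpha\le2$ let $S_\alpha$ be a symmetric stable random variable with $E e^{itS_\alpha}=e^{-|t|^\alpha}$, $t\in\mathbb R$. For $\beta>0$ let $V_\beta$ be a positive random variable with density $e^{-x^\beta}/\Gamma(1+1/\beta)$,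 $x>0$ (so $V_1\sim\mathrm{Exp}(1)$), independent of $S_\alpha$. 1. Let $0<\alpha\le2$. The Linnik variable $X_\alpha=S_\alpha V_1^{1/\alpha}$ has characteristic function $1/(1+|t|^\alpha)$, and for all complex $s$ with $-\min(\alpha,1)<\Re s<\alpha$ the moment $E|X_\alpha|^s$ converges absolutely and $$E|X_\alpha|^s=2^s\,\frac{\Gamma\left(\frac{1+s}2\right)\Gamma\left(1+\frac s\alpha\right)\Gamma\left(1-\frac s\alpha\right)}{\sqrt\pi\,\Gamma\left(1-\frac s2\right)}.$$ Moreover $\rho_+(X_\alpha)=\alpha$ if $\alpha<2$, $\rho_+(X_2)=\infty$, $\rho_-(X_\alpha)=-\min(\alpha,1)$, and on this strip $|X_\alpha|$ has moments of Gamma type with an expression whose parameters are $\gamma=2/\alpha$, $\gamma'=1$, $\delta=1/2$, $\kappa=0$, $C_1=2\sqrt{2\pi}/\alpha$. 2. Let $0<\alpha\le2$ and $\beta>0$. The variable $X_{\alpha,\beta}=S_\alpha V_\beta^{\beta/\alpha}$ has characteristic function $(1+|t|^\alpha)^{-1/\beta}$, and for all complex $s$ with $-\min(\alpha/\beta,1)<\Re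 s<\alpha$ the moment $E|X_{\alpha,\beta}|^s$ converges absolutely and $$E|X_{\alpha,\beta}|^s=2^s\,\frac{\Gamma\left(\frac{s+1}2\right)\Gamma\left(1-\frac s\alpha\right)\Gamma\left(\frac s\alpha+\frac1\beta\right)}{\sqrt\pi\,\Gamma\left(\frac1\beta\right)\Gamma\left(1-\frac s2\right)}.$$ Moreover $\rho_+(X_{\alpha,\beta})=\alpha$ if $\alpha<2$, $\rho_+(X_{2,\beta})=\infty$, $\rho_-(X_{\alpha,\beta})=-\min(\alpha/\beta,1)$, and on this strip $|X_{\alpha,\beta}|$ has moments of Gamma type with an expression whose parameters are $\gamma=2/\alpha$, $\gamma'=1$, $\delta=1/\beta-1/2$, $\kappa=0$. 3. Let $0<\alpha<\beta\le2$. Let $T,T'$ be independent positive $\alpha/\beta$-stable variables, i.e. $T,T'>0$ almost surely and $E e^{-tT}=E e^{-tT'}=e^{-t^{\alpha/\beta}}$ for $t>0$, and put $Y_{\alpha,\beta}=(T/T')^{1/\beta}$. If $X_\beta$ is a Linnik variable as in 1 (with $\beta$ in place of $\alpha$) that is independent of $Y_{\alpha,\beta}$, then $$X_\alpha\overset{d}{=}X_\beta\,Y_{\alpha,\beta}.$$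 -/

import Mathlib

open MeasureTheory ProbabilityTheory

noncomputable section

namespace LinnikDistribution

/-- `S` is a symmetric `α`-stable random variable with `E e^{itS} = e^{-|t|^α}`. -/
structure IsSymmetricStable {Ω : Type*} [MeasurableSpace Ω] (α : ℝ) (S : Ω → ℝ)
    (μ : Measure Ω) : Prop where
  aemeasurable : AEMeasurable S μ
  charFun_eq : ∀ t : ℝ, charFun (μ.map S) t = ((Real.exp (-|t| ^ α) : ℝ) : ℂ)

/-- `T` is a positive `a`-stable random variable with `E e^{-tT} = e^{-t^a}` for `t > 0`. -/
structure IsPositiveStable {Ω : Type*} [MeasurableSpace Ω] (a : ℝ) (T : Ω → ℝ)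
    (μ : Measure Ω) : Prop where
  aemeasurable : AEMeasurable T μ
  pos : ∀ᵐ ω ∂μ, 0 < T ω
  laplace_eq : ∀ t : ℝ, 0 < t → ∫ ω, Real.exp (-(t * T ω)) ∂μ = Real.exp (-t ^ a)

/-- The law on `(0, ∞)` with density `e^{-x^β} / Γ(1 + 1/β)`. -/
def genExpMeasure (β : ℝ) : Measure ℝ :=
  (volume.restrict (Set.Ioi 0)).withDensity
    fun x => ENNReal.ofReal (Real.exp (-x ^ β) / Real.Gamma (1 + 1 / β))

/-- The Linnik variable `S V^{1/α}`. -/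
def linnik {Ω : Type*} (α : ℝ) (S V : Ω → ℝ) : Ω → ℝ :=
  fun ω => S ω * V ω ^ (1 / α)

/-- The generalized Linnik variable `S V^{β/α}`. -/
def genLinnik {Ω : Type*} (α β : ℝ) (S V : Ω → ℝ) : Ω → ℝ :=
  fun ω => S ω * V ω ^ (β / α)

/-- The Lamperti variable `L = T / T'`. -/
def lamperti {Ω : Type*} (T T' : Ω → ℝ) : Ω → ℝ :=
  fun ω => T ω / T' ω

/-- The complex absolute moment `E |X|^s`, as a Bochner integral. -/
def absMoment {Ω : Type*} [MeasurableSpace Ω] (X : Ω → ℝ) (μ : Measure Ω) (s : ℂ) : ℂ :=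
  ∫ ω, ((|X ω| : ℝ) : ℂ) ^ s ∂μ

/-- `E |X|^s` converges absolutely; a negative real part forces `X ≠ 0` almost surely. -/
def HasAbsMoment {Ω : Type*} [MeasurableSpace Ω] (X : Ω → ℝ) (μ : Measure Ω) (s : ℂ) : Prop :=
  (s.re < 0 → ∀ᵐ ω ∂μ, X ω ≠ 0) ∧ Integrable (fun ω => ((|X ω| : ℝ) : ℂ) ^ s) μ

/-- The set of real `s` with `E |X|^s < ∞`, where `0^s = ∞` for `s < 0`. -/
def finiteMoments {Ω : Type*} [MeasurableSpace Ω] (X : Ω → ℝ) (μ : Measure Ω) : Set ℝ :=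
  {s | ∫⁻ ω, ENNReal.ofReal |X ω| ^ s ∂μ < ⊤}

/-- `ρ₊ = sup {s : E |X|^s < ∞}`. -/
def rhoPlus {Ω : Type*} [MeasurableSpace Ω] (X : Ω → ℝ) (μ : Measure Ω) : EReal :=
  ⨆ s ∈ finiteMoments X μ, (s : EReal)

/-- `ρ₋ = inf {s : E |X|^s < ∞}`. -/
def rhoMinus {Ω : Type*} [MeasurableSpace Ω] (X : Ω → ℝ) (μ : Measure Ω) : EReal :=
  ⨅ s ∈ finiteMoments X μ, (s : EReal)

/-- Data of an expression `C D^s ∏ⱼ Γ(aⱼ s + bⱼ) / ∏ₖ Γ(a'ₖ s + b'ₖ)`;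
the pairs `(aⱼ, bⱼ)` are listed in `num` and the pairs `(a'ₖ, b'ₖ)` in `den`. -/
structure GammaQuotient where
  C : ℝ
  D : ℝ
  num : List (ℝ × ℝ)
  den : List (ℝ × ℝ)
  D_pos : 0 < D
  num_ne : ∀ p ∈ num, p.1 ≠ 0
  den_ne : ∀ p ∈ den, p.1 ≠ 0

namespace GammaQuotient

def eval (g : GammaQuotient) (s : ℂ) : ℂ :=
  g.C * (g.D : ℂ) ^ s * (g.num.map fun p => Complex.Gamma (p.1 * s + p.2)).prod /
    (g.den.map fun p => Complex.Gamma (p.1 * s + p.2)).prod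

/-- `γ = ∑ |aⱼ| - ∑ |a'ₖ|`. -/
def gam (g : GammaQuotient) : ℝ :=
  (g.num.map fun p => |p.1|).sum - (g.den.map fun p => |p.1|).sum

/-- `γ' = ∑ aⱼ - ∑ a'ₖ`. -/
def gam' (g : GammaQuotient) : ℝ :=
  (g.num.map fun p => p.1).sum - (g.den.map fun p => p.1).sum

/-- `δ = ∑ bⱼ - ∑ b'ₖ - (J - K) / 2`. -/
def del (g : GammaQuotient) : ℝ :=
  (g.num.map fun p => p.2).sum - (g.den.map fun p => p.2).sum
    - ((g.num.length : ℝ) - (g.den.length : ℝ)) / 2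

/-- `κ = ∑ aⱼ log |aⱼ| - ∑ a'ₖ log |a'ₖ| + log D`. -/
def kap (g : GammaQuotient) : ℝ :=
  (g.num.map fun p => p.1 * Real.log |p.1|).sum
    - (g.den.map fun p => p.1 * Real.log |p.1|).sum + Real.log g.D

/-- `C₁ = |C| (2π)^{(J - K)/2} ∏ |aⱼ|^{bⱼ - 1/2} / ∏ |a'ₖ|^{b'ₖ - 1/2}`. -/
def C₁ (g : GammaQuotient) : ℝ :=
  |g.C| * (2 * Real.pi) ^ (((g.num.length : ℝ) - (g.den.length : ℝ)) / 2)
    * (g.num.map fun p => |p.1| ^ (p.2 - 1 / 2)).prod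
    / (g.den.map fun p => |p.1| ^ (p.2 - 1 / 2)).prod

end GammaQuotient

/-- `|X|` has moments of Gamma type: `E |X|^s` is finite and equal to the Gamma quotient `g`
in the strip `lo < Re s < hi`, where no numerator or denominator factor has a pole. -/
def HasGammaMoments {Ω : Type*} [MeasurableSpace Ω] (g : GammaQuotient) (X : Ω → ℝ)
    (μ : Measure Ω) (lo hi : ℝ) : Prop :=
  lo < hi ∧ ∀ s : ℂ, lo < s.re → s.re < hi →
    (∀ p ∈ g.num ++ g.den, ∀ m : ℕ, (p.1 : ℂ) * s + p.2 ≠ -(m : ℂ)) ∧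
    HasAbsMoment X μ s ∧ absMoment X μ s = g.eval s

end LinnikDistribution

end

open scoped ENNReal

namespace LinnikDistribution

/-- The Mellin transform of a nonnegative function, as a lower integral. -/
noncomputable def mellinL (f : ℝ → ℝ≥0∞) (r : ℝ) : ℝ≥0∞ :=
  ∫⁻ u in Set.Ioi (0 : ℝ), ENNReal.ofReal (u ^ (r - 1)) * f u

/-- The absolute moment of order `s` of a measure on the line. -/
noncomputable def absMom (P : Measure ℝ) (s : ℝ) : ℝ≥0∞ :=
  ∫⁻ x, ENNReal.ofReal |x| ^ s ∂P

lemma lintegral_Ioi_comp_mul_right (f : ℝ → ℝ≥0∞) {y : ℝ} (hy : 0 < y) :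
    ∫⁻ u in Set.Ioi (0 : ℝ), f u = ENNReal.ofReal y * ∫⁻ u in Set.Ioi (0 : ℝ), f (u * y) := by
  have h := lintegral_image_eq_lintegral_abs_deriv_mul (s := Set.Ioi (0 : ℝ))
    (f := fun u => u * y) (f' := fun _ => y) measurableSet_Ioi
    (fun x _ => (hasDerivAt_mul_const y).hasDerivWithinAt)
    (fun a _ b _ hab => mul_right_cancel₀ hy.ne' hab) f
  have himg : (fun u => u * y) '' Set.Ioi (0 : ℝ) = Set.Ioi 0 := by
    ext v
    exact ⟨fun ⟨u, hu, huv⟩ => huv ▸ mul_pos hu hy,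
      fun hv => ⟨v / y, div_pos hv hy, div_mul_cancel₀ v hy.ne'⟩⟩
  rw [himg] at h
  rw [h, abs_of_pos hy, lintegral_const_mul' _ _ ENNReal.ofReal_ne_top]

lemma mellinL_comp_mul_right (f : ℝ → ℝ≥0∞) (r : ℝ) {y : ℝ} (hy : 0 < y) :
    mellinL (fun u => f (u * y)) r = ENNReal.ofReal y ^ (-r) * mellinL f r := by
  have h : mellinL f r = ENNReal.ofReal (y ^ r) * mellinL (fun u => f (u * y)) r := by
    unfold mellinL
    rw [lintegral_Ioi_comp_mul_right _ hy, ← lintegral_const_mul' _ _ ENNReal.ofReal_ne_top,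
      ← lintegral_const_mul' _ _ ENNReal.ofReal_ne_top]
    refine setLIntegral_congr_fun measurableSet_Ioi fun u hu => ?_
    have hu : 0 < u := hu
    simp only
    rw [← mul_assoc, ← mul_assoc, ← ENNReal.ofReal_mul hy.le, ← ENNReal.ofReal_mul (by positivity),
      Real.mul_rpow hu.le hy.le]
    congr 2
    rw [Real.rpow_sub_one hy.ne']
    field_simp
  rw [h, ← mul_assoc, ENNReal.ofReal_rpow_of_pos hy, ← ENNReal.ofReal_mul (by positivity),
    ← Real.rpow_add hy]
  simp

lemma lintegral_Ioo_rpow_eq_top {s : ℝ} (hs : s ≤ -1) :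
    ∫⁻ u in Set.Ioo (0 : ℝ) 1, ENNReal.ofReal (u ^ s) = ⊤ := by
  by_contra h
  have := (intervalIntegral.integrableOn_Ioo_rpow_iff (s := s) (t := 1) one_pos).1 ?_
  · linarith
  · refine (lintegral_ofReal_ne_top_iff_integrable ?_ ?_).1 h
    · exact (measurable_id.pow_const s).aestronglyMeasurable
    · filter_upwards [ae_restrict_mem measurableSet_Ioo] with u hu
      exact Real.rpow_nonneg hu.1.le _

lemma lintegral_Ioi_rpow_eq_top (s : ℝ) :
    ∫⁻ u in Set.Ioi (0 : ℝ), ENNReal.ofReal (u ^ s) = ⊤ := by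
  by_contra h
  refine not_integrableOn_Ioi_rpow s ?_
  refine (lintegral_ofReal_ne_top_iff_integrable ?_ ?_).1 h
  · exact (measurable_id.pow_const s).aestronglyMeasurable
  · filter_upwards [ae_restrict_mem measurableSet_Ioi] with u hu
    exact Real.rpow_nonneg (le_of_lt hu) _

lemma lintegral_Ioo_rpow_lt_top {s : ℝ} (hs : -1 < s) :
    ∫⁻ u in Set.Ioo (0 : ℝ) 1, ENNReal.ofReal (u ^ s) < ⊤ := by
  have := (intervalIntegral.integrableOn_Ioo_rpow_iff (s := s) (t := 1) one_pos).2 hs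
  exact this.lintegral_lt_top

lemma lintegral_Ioi_one_rpow_lt_top {s : ℝ} (hs : s < -1) :
    ∫⁻ u in Set.Ici (1 : ℝ), ENNReal.ofReal (u ^ s) < ⊤ := by
  have := (integrableOn_Ioi_rpow_iff (s := s) (t := 1) one_pos).2 hs
  exact ((integrableOn_Ici_iff_integrableOn_Ioi).2 this).lintegral_lt_top

lemma mellinL_exp_neg_rpow {p r : ℝ} (hp : 0 < p) (hr : 0 < r) :
    mellinL (fun u => ENNReal.ofReal (Real.exp (-u ^ p))) r
      = ENNReal.ofReal (Real.Gamma (r / p) / p) := by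
  have h := integral_rpow_mul_exp_neg_rpow hp (q := r - 1) (by linarith)
  have h2 : Real.Gamma (r / p) / p = ∫ x in Set.Ioi (0 : ℝ), x ^ (r - 1) * Real.exp (-x ^ p) := by
    rw [h]; ring_nf
  rw [h2, ofReal_integral_eq_lintegral_ofReal]
  · unfold mellinL
    refine setLIntegral_congr_fun measurableSet_Ioi fun u hu => ?_
    exact (ENNReal.ofReal_mul (Real.rpow_nonneg (le_of_lt hu) _)).symm
  · exact integrableOn_rpow_mul_exp_neg_rpow (by linarith) hp
  · filter_upwards [ae_restrict_mem measurableSet_Ioi] with u hu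
    exact mul_nonneg (Real.rpow_nonneg (le_of_lt hu) _) (Real.exp_nonneg _)

lemma mellinL_exp_neg_rpow_of_nonpos {p r : ℝ} (hp : 0 < p) (hr : r ≤ 0) :
    mellinL (fun u => ENNReal.ofReal (Real.exp (-u ^ p))) r = ⊤ := by
  have h := lintegral_Ioo_rpow_eq_top (s := r - 1) (by linarith)
  have h1 : ∫⁻ u in Set.Ioo (0 : ℝ) 1, ENNReal.ofReal (u ^ (r - 1)) * ENNReal.ofReal (Real.exp (-1))
      ≤ mellinL (fun u => ENNReal.ofReal (Real.exp (-u ^ p))) r := by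
    refine le_trans ?_ (lintegral_mono_set (Set.Ioo_subset_Ioi_self : Set.Ioo (0 : ℝ) 1 ⊆ _))
    refine setLIntegral_mono' measurableSet_Ioo fun u hu => ?_
    refine mul_le_mul_right (ENNReal.ofReal_le_ofReal (Real.exp_le_exp.2 ?_)) _
    exact neg_le_neg (Real.rpow_le_one hu.1.le hu.2.le hp.le)
  rw [lintegral_mul_const' _ _ ENNReal.ofReal_ne_top, h, ENNReal.top_mul] at h1
  · exact top_le_iff.1 h1
  · simp [Real.exp_pos]

lemma mellinL_ne_zero {f : ℝ → ℝ≥0∞} (hf : Measurable f) (h : ∀ u, 0 < u → f u ≠ 0) (r : ℝ) :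
    mellinL f r ≠ 0 := by
  unfold mellinL
  rw [Ne, lintegral_eq_zero_iff (by fun_prop)]
  intro h0
  have : ∀ᵐ u : ℝ ∂(volume.restrict (Set.Ioi (0 : ℝ))), False := by
    filter_upwards [h0, ae_restrict_mem measurableSet_Ioi] with u hu hu'
    have hu' : 0 < u := hu'
    simp only [Pi.zero_apply, mul_eq_zero, ENNReal.ofReal_eq_zero, h u hu', or_false] at hu
    exact absurd hu (not_le.2 (Real.rpow_pos_of_pos hu' _))
  rw [ae_iff] at this
  simp at this

lemma mellinL_one_sub_exp_lt_top {p s : ℝ} (hs : 0 < s) (hsp : s < p) :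
    mellinL (fun u => ENNReal.ofReal (1 - Real.exp (-u ^ p))) (-s) < ⊤ := by
  unfold mellinL
  rw [← Set.Ioo_union_Ici_eq_Ioi (one_pos : (0 : ℝ) < 1)]
  refine lt_of_le_of_lt (lintegral_union_le _ _ _) (ENNReal.add_lt_top.2 ⟨?_, ?_⟩)
  · refine lt_of_le_of_lt (setLIntegral_mono' measurableSet_Ioo fun u hu => ?_)
      (lintegral_Ioo_rpow_lt_top (s := p - s - 1) (by linarith))
    rw [← ENNReal.ofReal_mul (Real.rpow_nonneg hu.1.le _)]
    refine ENNReal.ofReal_le_ofReal ?_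
    calc u ^ (-s - 1) * (1 - Real.exp (-u ^ p)) ≤ u ^ (-s - 1) * u ^ p := by
          gcongr
          · exact Real.rpow_nonneg hu.1.le _
          · linarith [Real.add_one_le_exp (-u ^ p)]
      _ = u ^ (p - s - 1) := by rw [← Real.rpow_add hu.1]; congr 1; ring
  · refine lt_of_le_of_lt (setLIntegral_mono' measurableSet_Ici fun u hu => ?_)
      (lintegral_Ioi_one_rpow_lt_top (s := - s - 1) (by linarith))
    refine mul_le_of_le_one_right' ?_
    rw [ENNReal.ofReal_le_one]
    linarith [Real.exp_pos (-u ^ p)]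

lemma mellinL_one_sub_exp_eq_top {p s : ℝ} (hp : 0 < p) (hsp : p ≤ s) :
    mellinL (fun u => ENNReal.ofReal (1 - Real.exp (-u ^ p))) (-s) = ⊤ := by
  have h := lintegral_Ioo_rpow_eq_top (s := p - s - 1) (by linarith)
  have h1 : ∫⁻ u in Set.Ioo (0 : ℝ) 1, ENNReal.ofReal (u ^ (p - s - 1)) * ENNReal.ofReal (1 / 2)
      ≤ mellinL (fun u => ENNReal.ofReal (1 - Real.exp (-u ^ p))) (-s) := by
    refine le_trans ?_ (lintegral_mono_set (Set.Ioo_subset_Ioi_self : Set.Ioo (0 : ℝ) 1 ⊆ _))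
    refine setLIntegral_mono' measurableSet_Ioo fun u hu => ?_
    rw [← ENNReal.ofReal_mul (Real.rpow_nonneg hu.1.le _),
      ← ENNReal.ofReal_mul (Real.rpow_nonneg hu.1.le _)]
    refine ENNReal.ofReal_le_ofReal ?_
    have h0 : u ^ (p - s - 1) = u ^ (-s - 1) * u ^ p := by
      rw [← Real.rpow_add hu.1]; congr 1; ring
    rw [h0, mul_assoc]
    refine mul_le_mul_of_nonneg_left ?_ (Real.rpow_nonneg hu.1.le _)
    have hx1 : u ^ p ≤ 1 := Real.rpow_le_one hu.1.le hu.2.le hp.le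
    have hx0 : 0 ≤ u ^ p := Real.rpow_nonneg hu.1.le _
    set x := u ^ p
    have h2 : Real.exp (-x) ≤ 1 / (1 + x) := by
      rw [Real.exp_neg, ← one_div]
      exact one_div_le_one_div_of_le (by linarith) (by linarith [Real.add_one_le_exp x])
    have h3 : 1 / (1 + x) ≤ 1 - x * (1 / 2) := by
      rw [div_le_iff₀ (by linarith)]; nlinarith
    linarith
  rw [lintegral_mul_const' _ _ ENNReal.ofReal_ne_top, h, ENNReal.top_mul] at h1
  · exact top_le_iff.1 h1
  · simp

/-- If `E f(u|X|) = E g(u|Y|)` for all `u > 0`, the absolute moments of `X` and `Y` are related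
by the Mellin transforms of `f` and `g`. -/
lemma absMom_mul_mellinL_eq {P Q : Measure ℝ} [SFinite P] [SFinite Q] {f g : ℝ → ℝ≥0∞} {r : ℝ}
    (hf : Measurable f) (hg : Measurable g)
    (hf0 : mellinL (fun _ => f 0) r = 0 ^ (-r) * mellinL f r)
    (hg0 : mellinL (fun _ => g 0) r = 0 ^ (-r) * mellinL g r)
    (h : ∀ u, 0 < u → ∫⁻ x, f (u * |x|) ∂P = ∫⁻ x, g (u * |x|) ∂Q) :
    absMom P (-r) * mellinL f r = absMom Q (-r) * mellinL g r := by
  have key : ∀ (M : Measure ℝ) [SFinite M] (k : ℝ → ℝ≥0∞), Measurable k →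
      mellinL (fun _ => k 0) r = 0 ^ (-r) * mellinL k r →
      absMom M (-r) * mellinL k r = mellinL (fun u => ∫⁻ x, k (u * |x|) ∂M) r := by
    intro M _ k hk hk0
    have h1 : ∀ x : ℝ, ENNReal.ofReal |x| ^ (-r) * mellinL k r
        = mellinL (fun u => k (u * |x|)) r := by
      intro x
      rcases eq_or_ne x 0 with rfl | hx
      · simpa using hk0.symm
      · exact (mellinL_comp_mul_right k r (abs_pos.2 hx)).symm
    unfold absMom
    rw [← lintegral_mul_const _ (by fun_prop)]
    simp_rw [h1, mellinL]
    rw [lintegral_lintegral_swap (by fun_prop)]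
    refine lintegral_congr fun u => ?_
    rw [lintegral_const_mul _ (by fun_prop)]
  rw [key P f hf hf0, key Q g hg hg0]
  unfold mellinL
  refine setLIntegral_congr_fun measurableSet_Ioi fun u hu => ?_
  simp only [h u hu]

/-- Exchange of two symmetric stable laws in the Parseval identity. -/
lemma integral_exp_neg_rpow_eq {P Q : Measure ℝ} [IsProbabilityMeasure P] [IsProbabilityMeasure Q]
    {a b : ℝ} (hP : ∀ t : ℝ, charFun P t = ((Real.exp (-|t| ^ a) : ℝ) : ℂ))
    (hQ : ∀ t : ℝ, charFun Q t = ((Real.exp (-|t| ^ b) : ℝ) : ℂ)) {u : ℝ} (hu : 0 < u) :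
    ∫ x, Real.exp (-(u * |x|) ^ b) ∂P = ∫ y, Real.exp (-(u * |y|) ^ a) ∂Q := by
  have h1 : ∫ x, charFun Q (u * x) ∂P = ∫ y, charFun P (u * y) ∂Q := by
    simp_rw [charFun_apply_real]
    rw [integral_integral_swap]
    · refine integral_congr_ae (ae_of_all _ fun y => integral_congr_ae (ae_of_all _ fun x => ?_))
      simp only [Complex.ofReal_mul]
      ring_nf
    · refine Integrable.of_bound (C := 1) (Continuous.aestronglyMeasurable
        (by simp only [Function.uncurry_def]; fun_prop)) (ae_of_all _ fun p => le_of_eq ?_)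
      simp only [Function.uncurry_def]
      rw [← Complex.norm_exp_ofReal_mul_I (u * p.1 * p.2)]
      push_cast
      rfl
  simp_rw [hP, hQ, abs_mul, abs_of_pos hu] at h1
  rw [integral_complex_ofReal, integral_complex_ofReal] at h1
  exact_mod_cast h1

lemma integrable_exp_neg_rpow (P : Measure ℝ) [IsProbabilityMeasure P] (b u : ℝ) (hu : 0 ≤ u) :
    Integrable (fun x : ℝ => Real.exp (-(u * |x|) ^ b)) P := by
  refine Integrable.of_bound (C := 1) (Measurable.aestronglyMeasurable (by fun_prop))
    (ae_of_all _ fun x => ?_)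
  rw [Real.norm_of_nonneg (Real.exp_nonneg _), Real.exp_le_one_iff, neg_nonpos]
  positivity

section Stable

variable {P Q : Measure ℝ} [IsProbabilityMeasure P] [IsProbabilityMeasure Q] {a b : ℝ}

lemma absMom_neg_mul_eq (ha : 0 < a) (hb : 0 < b)
    (hP : ∀ t : ℝ, charFun P t = ((Real.exp (-|t| ^ a) : ℝ) : ℂ))
    (hQ : ∀ t : ℝ, charFun Q t = ((Real.exp (-|t| ^ b) : ℝ) : ℂ)) {r : ℝ} (hr : 0 < r) :
    absMom P (-r) * ENNReal.ofReal (Real.Gamma (r / b) / b)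
      = absMom Q (-r) * ENNReal.ofReal (Real.Gamma (r / a) / a) := by
  rw [← mellinL_exp_neg_rpow ha hr, ← mellinL_exp_neg_rpow hb hr]
  have h0 : ∀ {p : ℝ}, 0 < p → mellinL (fun _ => ENNReal.ofReal (Real.exp (-(0 : ℝ) ^ p))) r
      = 0 ^ (-r) * mellinL (fun u => ENNReal.ofReal (Real.exp (-u ^ p))) r := by
    intro p hp
    rw [ENNReal.zero_rpow_of_neg (by linarith), ENNReal.top_mul]
    · simp [mellinL, Real.zero_rpow hp.ne', lintegral_Ioi_rpow_eq_top]
    · exact mellinL_ne_zero (by fun_prop) (fun u _ => by simp [Real.exp_pos]) r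
  refine absMom_mul_mellinL_eq (by fun_prop) (by fun_prop) (h0 hb) (h0 ha) fun u hu => ?_
  rw [← ofReal_integral_eq_lintegral_ofReal (integrable_exp_neg_rpow P b u hu.le)
    (ae_of_all _ fun x => Real.exp_nonneg _), ← ofReal_integral_eq_lintegral_ofReal
    (integrable_exp_neg_rpow Q a u hu.le) (ae_of_all _ fun x => Real.exp_nonneg _),
    integral_exp_neg_rpow_eq hP hQ hu]

lemma absMom_mul_eq (ha : 0 < a) (hb : 0 < b)
    (hP : ∀ t : ℝ, charFun P t = ((Real.exp (-|t| ^ a) : ℝ) : ℂ))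
    (hQ : ∀ t : ℝ, charFun Q t = ((Real.exp (-|t| ^ b) : ℝ) : ℂ)) {s : ℝ} (hs : 0 < s) :
    absMom P s * mellinL (fun u => ENNReal.ofReal (1 - Real.exp (-u ^ b))) (-s)
      = absMom Q s * mellinL (fun u => ENNReal.ofReal (1 - Real.exp (-u ^ a))) (-s) := by
  have h0 : ∀ {p : ℝ}, 0 < p → mellinL (fun _ => ENNReal.ofReal (1 - Real.exp (-(0 : ℝ) ^ p))) (-s)
      = 0 ^ (-(-s)) * mellinL (fun u => ENNReal.ofReal (1 - Real.exp (-u ^ p))) (-s) := by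
    intro p hp
    rw [neg_neg, ENNReal.zero_rpow_of_pos hs]
    simp [mellinL, Real.zero_rpow hp.ne']
  rw [← neg_neg s, neg_neg (-s)]
  refine absMom_mul_mellinL_eq (by fun_prop) (by fun_prop) (h0 hb) (h0 ha) fun u hu => ?_
  have h1 : ∀ (M : Measure ℝ) [IsProbabilityMeasure M] (p : ℝ),
      ∫⁻ x, ENNReal.ofReal (1 - Real.exp (-(u * |x|) ^ p)) ∂M
        = ENNReal.ofReal (1 - ∫ x, Real.exp (-(u * |x|) ^ p) ∂M) := by
    intro M _ p
    have hi := integrable_exp_neg_rpow M p u hu.le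
    have hj : Integrable (fun x => 1 - Real.exp (-(u * |x|) ^ p)) M := (integrable_const 1).sub hi
    rw [← ofReal_integral_eq_lintegral_ofReal hj,
      integral_sub (integrable_const 1) hi]
    · simp
    · refine ae_of_all _ fun x => ?_
      simp only [Pi.zero_apply, sub_nonneg, Real.exp_le_one_iff, neg_nonpos]
      positivity
  rw [h1, h1, integral_exp_neg_rpow_eq hP hQ hu]

end Stable

lemma lintegral_comp_abs (f : ℝ → ℝ≥0∞) :
    ∫⁻ x, f |x| = 2 * ∫⁻ x in Set.Ioi (0 : ℝ), f x := by
  rw [← lintegral_add_compl _ (measurableSet_Ioi (a := (0 : ℝ))), Set.compl_Ioi, two_mul]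
  congr 1
  · exact setLIntegral_congr_fun measurableSet_Ioi fun x hx => by
      simp only [abs_of_pos (Set.mem_Ioi.1 hx)]
  · have h := (Measure.measurePreserving_neg (volume : Measure ℝ)).setLIntegral_comp_preimage_emb
      (MeasurableEquiv.neg ℝ).measurableEmbedding (fun x => f |x|) (Set.Iic (0 : ℝ))
    simp only [abs_neg] at h
    rw [← h, show (Neg.neg ⁻¹' Set.Iic (0 : ℝ)) = Set.Ici 0 by ext; simp,
      setLIntegral_congr Ioi_ae_eq_Ici.symm]
    exact setLIntegral_congr_fun measurableSet_Ioi fun x hx => by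
      simp only [abs_of_pos (Set.mem_Ioi.1 hx)]

lemma charFun_gaussianReal_two (t : ℝ) :
    charFun (gaussianReal 0 2) t = ((Real.exp (-|t| ^ (2 : ℝ)) : ℝ) : ℂ) := by
  rw [charFun_gaussianReal]
  push_cast
  congr 1
  rw [Real.rpow_two, sq_abs]
  simp

lemma absMom_gaussianReal_two_eq_mellinL (s : ℝ) :
    absMom (gaussianReal 0 2) s = 2 * (ENNReal.ofReal ((√(4 * Real.pi))⁻¹) *
      (ENNReal.ofReal (1 / 2) ^ (-(s + 1)) *
        mellinL (fun u => ENNReal.ofReal (Real.exp (-u ^ (2 : ℝ)))) (s + 1))) := by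
  rw [← mellinL_comp_mul_right _ _ (by norm_num : (0 : ℝ) < 1 / 2)]
  unfold absMom mellinL
  rw [gaussianReal_of_var_ne_zero _ two_ne_zero,
    lintegral_withDensity_eq_lintegral_mul _ (measurable_gaussianPDF _ _) (by fun_prop),
    ← lintegral_const_mul' _ _ ENNReal.ofReal_ne_top]
  have := lintegral_comp_abs fun x => gaussianPDF 0 2 x * ENNReal.ofReal x ^ s
  refine Eq.trans (lintegral_congr fun x => ?_) (this.trans ?_)
  · simp [gaussianPDF, gaussianPDFReal]
  · congr 1
    refine setLIntegral_congr_fun measurableSet_Ioi fun x hx => ?_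
    have hx : 0 < x := hx
    simp only [gaussianPDF, gaussianPDFReal, ENNReal.ofReal_rpow_of_pos hx]
    rw [ENNReal.ofReal_mul (by positivity), mul_assoc, mul_comm (ENNReal.ofReal (Real.exp _))]
    rw [show -(x - 0) ^ 2 / (2 * ((2 : NNReal) : ℝ)) = -(x * (1 / 2)) ^ (2 : ℝ) by
        simp only [NNReal.coe_ofNat, Real.rpow_ofNat]; ring,
      show 2 * Real.pi * ((2 : NNReal) : ℝ) = 4 * Real.pi by
        simp only [NNReal.coe_ofNat]; ring, add_sub_cancel_right]

lemma absMom_gaussianReal_two {s : ℝ} (hs : -1 < s) :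
    absMom (gaussianReal 0 2) s
      = ENNReal.ofReal (2 ^ s * Real.Gamma ((1 + s) / 2) / √Real.pi) := by
  rw [absMom_gaussianReal_two_eq_mellinL, mellinL_exp_neg_rpow two_pos (by linarith),
    ENNReal.ofReal_rpow_of_pos (by norm_num), ← ENNReal.ofReal_mul (by positivity),
    ← ENNReal.ofReal_mul (by positivity), ← ENNReal.ofReal_ofNat,
    ← ENNReal.ofReal_mul (by positivity)]
  congr 1
  rw [Real.sqrt_mul (by norm_num), show √(4 : ℝ) = 2 by
    rw [show (4 : ℝ) = 2 ^ 2 by norm_num]; exact Real.sqrt_sq (by norm_num), one_div,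
    Real.inv_rpow (by norm_num), Real.rpow_neg (by norm_num), inv_inv,
    Real.rpow_add_one (by norm_num), add_comm s 1]
  field_simp

lemma absMom_gaussianReal_two_eq_top {s : ℝ} (hs : s ≤ -1) :
    absMom (gaussianReal 0 2) s = ⊤ := by
  rw [absMom_gaussianReal_two_eq_mellinL, mellinL_exp_neg_rpow_of_nonpos two_pos (by linarith),
    ENNReal.ofReal_rpow_of_pos (by norm_num), ENNReal.mul_top, ENNReal.mul_top, ENNReal.mul_top]
  · simp
  · simp only [ne_eq, ENNReal.ofReal_eq_zero, not_le]; positivity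
  · simp only [ne_eq, ENNReal.ofReal_eq_zero, not_le]; positivity

lemma absMom_gaussianReal_two_ne_zero (s : ℝ) : absMom (gaussianReal 0 2) s ≠ 0 := by
  rcases le_or_gt s (-1) with h | h
  · rw [absMom_gaussianReal_two_eq_top h]; exact ENNReal.top_ne_zero
  · rw [absMom_gaussianReal_two h, Ne, ENNReal.ofReal_eq_zero, not_le]
    have := Real.Gamma_pos_of_pos (s := (1 + s) / 2) (by linarith)
    positivity

section Stable

variable {P : Measure ℝ} [IsProbabilityMeasure P] {α : ℝ}

lemma absMom_stable_of_neg (hα : 0 < α)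
    (hP : ∀ t : ℝ, charFun P t = ((Real.exp (-|t| ^ α) : ℝ) : ℂ)) {s : ℝ} (h1 : -1 < s)
    (h0 : s < 0) :
    absMom P s = ENNReal.ofReal (2 ^ s * Real.Gamma ((1 + s) / 2) * Real.Gamma (1 - s / α) /
      (√Real.pi * Real.Gamma (1 - s / 2))) := by
  have h := absMom_neg_mul_eq hα two_pos hP charFun_gaussianReal_two (r := -s) (by linarith)
  have hg2 : 0 < Real.Gamma (-s / 2) := Real.Gamma_pos_of_pos (by linarith)
  have hga : 0 < Real.Gamma (-s / α) := Real.Gamma_pos_of_pos (div_pos (by linarith) hα)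
  have hg1 : 0 < Real.Gamma ((1 + s) / 2) := Real.Gamma_pos_of_pos (by linarith)
  rw [neg_neg, absMom_gaussianReal_two h1, ← ENNReal.ofReal_mul (by positivity)] at h
  have hne : ENNReal.ofReal (Real.Gamma (-s / 2) / 2) ≠ 0 := by
    rw [Ne, ENNReal.ofReal_eq_zero, not_le]; positivity
  rw [(ENNReal.eq_div_iff hne ENNReal.ofReal_ne_top).2 ((mul_comm _ _).trans h),
    ← ENNReal.ofReal_div_of_pos (by positivity)]
  congr 1
  rw [show 1 - s / α = -s / α + 1 by ring, show 1 - s / 2 = -s / 2 + 1 by ring,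
    Real.Gamma_add_one (by rw [neg_div, neg_ne_zero]; exact div_ne_zero h0.ne hα.ne'),
    Real.Gamma_add_one (by linarith)]
  have := h0.ne
  field_simp

lemma absMom_stable_eq_top_of_le_neg_one (hα : 0 < α)
    (hP : ∀ t : ℝ, charFun P t = ((Real.exp (-|t| ^ α) : ℝ) : ℂ)) {s : ℝ} (h1 : s ≤ -1) :
    absMom P s = ⊤ := by
  have h := absMom_neg_mul_eq hα two_pos hP charFun_gaussianReal_two (r := -s) (by linarith)
  have hga : 0 < Real.Gamma (-s / α) := Real.Gamma_pos_of_pos (div_pos (by linarith) hα)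
  rw [neg_neg, absMom_gaussianReal_two_eq_top h1, ENNReal.top_mul (by
    rw [Ne, ENNReal.ofReal_eq_zero, not_le]; positivity)] at h
  by_contra hne
  exact ENNReal.mul_ne_top hne ENNReal.ofReal_ne_top h

lemma mellinL_one_sub_exp_ne_zero {p : ℝ} (r : ℝ) :
    mellinL (fun u => ENNReal.ofReal (1 - Real.exp (-u ^ p))) r ≠ 0 := by
  refine mellinL_ne_zero (by fun_prop) (fun u hu => ?_) r
  simp only [ne_eq, ENNReal.ofReal_eq_zero, not_le, sub_pos, Real.exp_lt_one_iff, neg_lt_zero]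
  positivity

lemma absMom_stable_lt_top_of_pos
    (hP : ∀ t : ℝ, charFun P t = ((Real.exp (-|t| ^ α) : ℝ) : ℂ)) {s : ℝ} (h0 : 0 < s)
    (hs : s < α) : absMom P s < ⊤ := by
  have h := absMom_mul_eq (h0.trans hs) two_pos hP charFun_gaussianReal_two h0
  rw [absMom_gaussianReal_two (by linarith)] at h
  by_contra hne
  rw [not_lt, top_le_iff] at hne
  rw [hne, ENNReal.top_mul (mellinL_one_sub_exp_ne_zero _)] at h
  exact ENNReal.mul_ne_top ENNReal.ofReal_ne_top (mellinL_one_sub_exp_lt_top h0 hs).ne h.symm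

lemma absMom_stable_eq_top (hα : 0 < α)
    (hP : ∀ t : ℝ, charFun P t = ((Real.exp (-|t| ^ α) : ℝ) : ℂ)) {s : ℝ} (h0 : α ≤ s)
    (hs : s < 2) : absMom P s = ⊤ := by
  have h := absMom_mul_eq hα two_pos hP charFun_gaussianReal_two (hα.trans_le h0)
  rw [mellinL_one_sub_exp_eq_top hα h0, ENNReal.mul_top (absMom_gaussianReal_two_ne_zero s)] at h
  by_contra hne
  exact ENNReal.mul_ne_top hne (mellinL_one_sub_exp_lt_top (hα.trans_le h0) hs).ne h

lemma absMom_zero : absMom P 0 = 1 := by simp [absMom]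

lemma absMom_stable_two_lt_top
    (hP : ∀ t : ℝ, charFun P t = ((Real.exp (-|t| ^ (2 : ℝ)) : ℝ) : ℂ)) {s : ℝ} (h1 : -1 < s) :
    absMom P s < ⊤ := by
  have : P = gaussianReal 0 2 :=
    Measure.ext_of_charFun (funext fun t => (hP t).trans (charFun_gaussianReal_two t).symm)
  rw [this, absMom_gaussianReal_two h1]
  exact ENNReal.ofReal_lt_top

lemma absMom_stable_lt_top (hα : 0 < α)
    (hP : ∀ t : ℝ, charFun P t = ((Real.exp (-|t| ^ α) : ℝ) : ℂ)) {s : ℝ} (h1 : -1 < s)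
    (hs : s < α) : absMom P s < ⊤ := by
  rcases lt_trichotomy s 0 with h | rfl | h
  · rw [absMom_stable_of_neg hα hP h1 h]; exact ENNReal.ofReal_lt_top
  · simp [absMom_zero]
  · exact absMom_stable_lt_top_of_pos hP h hs

/-- A moment of negative order does not vanish. -/
lemma absMom_ne_zero_of_neg {s : ℝ} (h0 : s < 0) : absMom P s ≠ 0 := by
  unfold absMom
  rw [Ne, lintegral_eq_zero_iff (by fun_prop)]
  intro h
  have : ∀ᵐ x ∂P, False := by
    filter_upwards [h] with x hx
    simp [ENNReal.rpow_eq_zero_iff, h0.not_gt] at hx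
  exact IsProbabilityMeasure.ne_zero P (by simpa using this)

end Stable

section GenExp

variable {β : ℝ}

lemma absMom_genExpMeasure_eq_mellinL (s : ℝ) :
    absMom (genExpMeasure β) s = ENNReal.ofReal (Real.Gamma (1 + 1 / β))⁻¹ *
      mellinL (fun u => ENNReal.ofReal (Real.exp (-u ^ β))) (s + 1) := by
  unfold absMom genExpMeasure mellinL
  rw [lintegral_withDensity_eq_lintegral_mul _ (by fun_prop) (by fun_prop),
    ← lintegral_const_mul' _ _ ENNReal.ofReal_ne_top]
  refine setLIntegral_congr_fun measurableSet_Ioi fun x hx => ?_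
  have hx : 0 < x := hx
  simp only [Pi.mul_apply, abs_of_pos hx, ENNReal.ofReal_rpow_of_pos hx, add_sub_cancel_right]
  rw [div_eq_inv_mul, ENNReal.ofReal_mul' (Real.exp_nonneg _)]
  ring

lemma absMom_genExpMeasure (hβ : 0 < β) {s : ℝ} (hs : -1 < s) :
    absMom (genExpMeasure β) s
      = ENNReal.ofReal (Real.Gamma ((s + 1) / β) / Real.Gamma (1 / β)) := by
  have hb : 0 < 1 / β := by positivity
  have := Real.Gamma_pos_of_pos hb
  have h1 : 0 < Real.Gamma (1 + 1 / β) := Real.Gamma_pos_of_pos (by positivity)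
  rw [absMom_genExpMeasure_eq_mellinL, mellinL_exp_neg_rpow hβ (by linarith),
    ← ENNReal.ofReal_mul (by positivity)]
  congr 1
  rw [add_comm 1, Real.Gamma_add_one hb.ne']
  field_simp

lemma absMom_genExpMeasure_eq_top (hβ : 0 < β) {s : ℝ} (hs : s ≤ -1) :
    absMom (genExpMeasure β) s = ⊤ := by
  rw [absMom_genExpMeasure_eq_mellinL, mellinL_exp_neg_rpow_of_nonpos hβ (by linarith),
    ENNReal.mul_top]
  have h1 : 0 < Real.Gamma (1 + 1 / β) := Real.Gamma_pos_of_pos (by positivity)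
  rw [Ne, ENNReal.ofReal_eq_zero, not_le]
  positivity

lemma absMom_genExpMeasure_ne_zero (hβ : 0 < β) (s : ℝ) : absMom (genExpMeasure β) s ≠ 0 := by
  rcases le_or_gt s (-1) with h | h
  · rw [absMom_genExpMeasure_eq_top hβ h]; exact ENNReal.top_ne_zero
  · rw [absMom_genExpMeasure hβ h, Ne, ENNReal.ofReal_eq_zero, not_le]
    exact div_pos (Real.Gamma_pos_of_pos (div_pos (by linarith) hβ))
      (Real.Gamma_pos_of_pos (by positivity))

lemma ae_pos_genExpMeasure : ∀ᵐ x ∂(genExpMeasure β), 0 < x :=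
  (withDensity_absolutelyContinuous _ _).ae_le (ae_restrict_mem measurableSet_Ioi)

lemma expMeasure_one : expMeasure 1 = genExpMeasure 1 := by
  unfold expMeasure gammaMeasure genExpMeasure
  rw [← withDensity_indicator measurableSet_Ioi]
  refine withDensity_congr_ae ?_
  have h0 : ∀ᵐ x : ℝ, x ≠ 0 := by simp [ae_iff]
  filter_upwards [h0] with x hx
  rcases lt_or_gt_of_ne hx with h | h
  · simp [gammaPDF, gammaPDFReal, h.not_ge, h.le]
  · simp [gammaPDF, gammaPDFReal, h.le, h, one_add_one_eq_two]

/-- The Laplace transform at `c` of the `β`-th power of the variable. -/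
lemma integral_exp_neg_mul_rpow_genExpMeasure (hβ : 0 < β) {c : ℝ} (hc : 0 ≤ c) :
    ∫ x, Real.exp (-(c * x ^ β)) ∂(genExpMeasure β) = 1 / (1 + c) ^ (1 / β) := by
  unfold genExpMeasure
  have h1 : 0 < Real.Gamma (1 + 1 / β) := Real.Gamma_pos_of_pos (by positivity)
  rw [integral_withDensity_eq_integral_toReal_smul (by fun_prop)
    (ae_of_all _ fun x => ENNReal.ofReal_lt_top)]
  have h : ∀ x : ℝ, (ENNReal.ofReal (Real.exp (-x ^ β) / Real.Gamma (1 + 1 / β))).toReal •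
      Real.exp (-(c * x ^ β))
      = (Real.Gamma (1 + 1 / β))⁻¹ * Real.exp (-(1 + c) * x ^ β) := by
    intro x
    rw [ENNReal.toReal_ofReal (by positivity), smul_eq_mul, div_mul_eq_mul_div, ← Real.exp_add]
    ring_nf
  simp_rw [h]
  rw [integral_const_mul, integral_exp_neg_mul_rpow hβ (by linarith), add_comm (1 / β), neg_div,
    Real.rpow_neg (by linarith)]
  field_simp

end GenExp

section Continuation

variable {Ω : Type*} [MeasurableSpace Ω] {μ : Measure Ω} {X : Ω → ℝ}

lemma ofReal_abs_rpow_eq {x : ℝ} (hx : x ≠ 0) (s : ℝ) :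
    ENNReal.ofReal |x| ^ s = ENNReal.ofReal (Real.exp (s * Real.log |x|)) := by
  have h := abs_pos.2 hx
  rw [ENNReal.ofReal_rpow_of_pos h, Real.rpow_def_of_pos h, mul_comm]

lemma abs_cpow_eq {x : ℝ} (hx : x ≠ 0) (s : ℂ) :
    ((|x| : ℝ) : ℂ) ^ s = Complex.exp (s * (Real.log |x| : ℝ)) := by
  rw [Complex.cpow_def_of_ne_zero (by simpa using hx), ← Complex.ofReal_log (abs_nonneg x),
    mul_comm]

lemma mem_integrableExpSet_log_abs (hX : AEMeasurable X μ) (h0 : ∀ᵐ ω ∂μ, X ω ≠ 0) {s : ℝ}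
    (hs : s ∈ finiteMoments X μ) : s ∈ integrableExpSet (fun ω => Real.log |X ω|) μ := by
  have hm : AEMeasurable (fun ω => Real.exp (s * Real.log |X ω|)) μ := by fun_prop
  refine (lintegral_ofReal_ne_top_iff_integrable hm.aestronglyMeasurable
    (ae_of_all _ fun ω => Real.exp_nonneg _)).1 (ne_of_lt ?_)
  rw [← lintegral_congr_ae (h0.mono fun ω hω => ofReal_abs_rpow_eq hω s)]
  exact hs

lemma ae_ne_zero_of_mem_finiteMoments (hX : AEMeasurable X μ) {s : ℝ} (hs : s < 0)
    (h : s ∈ finiteMoments X μ) : ∀ᵐ ω ∂μ, X ω ≠ 0 := by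
  filter_upwards [ae_lt_top' (by fun_prop) (ne_of_lt h)] with ω hω h0
  simp [h0, ENNReal.zero_rpow_of_neg hs] at hω

lemma mgf_log_abs (hX : AEMeasurable X μ) (h0 : ∀ᵐ ω ∂μ, X ω ≠ 0) (s : ℝ) :
    mgf (fun ω => Real.log |X ω|) μ s = (∫⁻ ω, ENNReal.ofReal |X ω| ^ s ∂μ).toReal := by
  have hm : AEMeasurable (fun ω => Real.exp (s * Real.log |X ω|)) μ := by fun_prop
  rw [lintegral_congr_ae (h0.mono fun ω hω => ofReal_abs_rpow_eq hω s)]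
  exact integral_eq_lintegral_of_nonneg_ae (ae_of_all _ fun ω => Real.exp_nonneg _)
    hm.aestronglyMeasurable

lemma absMoment_eq_complexMGF (h0 : ∀ᵐ ω ∂μ, X ω ≠ 0) (s : ℂ) :
    absMoment X μ s = complexMGF (fun ω => Real.log |X ω|) μ s :=
  integral_congr_ae (h0.mono fun _ hω => abs_cpow_eq hω s)

lemma hasAbsMoment_of_mem_finiteMoments (hX : AEMeasurable X μ) (h0 : ∀ᵐ ω ∂μ, X ω ≠ 0) {s : ℂ}
    (hs : s.re ∈ finiteMoments X μ) : HasAbsMoment X μ s := by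
  refine ⟨fun _ => h0, ?_⟩
  have h : Integrable (fun ω => Complex.exp (s * (Real.log |X ω| : ℝ))) μ := by
    have hm : AEMeasurable (fun ω => Complex.exp (s * (Real.log |X ω| : ℝ))) μ := by fun_prop
    rw [← integrable_norm_iff hm.aestronglyMeasurable]
    simpa [Complex.norm_exp] using! mem_integrableExpSet_log_abs hX h0 hs
  exact h.congr (h0.mono fun ω hω => (abs_cpow_eq hω s).symm)

/-- Analytic continuation of a formula for the absolute moments, from a real interval to
a vertical strip. -/
lemma absMoment_eq_of_analytic (hX : AEMeasurable X μ) (h0 : ∀ᵐ ω ∂μ, X ω ≠ 0)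
    {lo c hi : ℝ} (hlo : lo < c) (hc : c ≤ hi)
    (hfin : ∀ s, lo < s → s < hi → s ∈ finiteMoments X μ) {G : ℂ → ℂ}
    (hG : DifferentiableOn ℂ G {z | lo < z.re ∧ z.re < hi})
    (heq : ∀ s : ℝ, lo < s → s < c →
      (((∫⁻ ω, ENNReal.ofReal |X ω| ^ s ∂μ).toReal : ℝ) : ℂ) = G s)
    {s : ℂ} (hs1 : lo < s.re) (hs2 : s.re < hi) : absMoment X μ s = G s := by
  rw [absMoment_eq_complexMGF h0]
  have hset : {z : ℂ | lo < z.re ∧ z.re < hi} = Complex.reLm ⁻¹' (Set.Ioo lo hi) := rfl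
  have hopen : IsOpen {z : ℂ | lo < z.re ∧ z.re < hi} :=
    isOpen_Ioo.preimage Complex.continuous_re
  have hsub : Set.Ioo lo hi ⊆ interior (integrableExpSet (fun ω => Real.log |X ω|) μ) :=
    interior_maximal (fun t ht => mem_integrableExpSet_log_abs hX h0 (hfin t ht.1 ht.2)) isOpen_Ioo
  have hA : AnalyticOnNhd ℂ (complexMGF (fun ω => Real.log |X ω|) μ)
      {z | lo < z.re ∧ z.re < hi} :=
    fun z hz => analyticOnNhd_complexMGF z (hsub hz)
  obtain ⟨t, ht1, ht2⟩ := exists_between hlo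
  refine AnalyticOnNhd.eqOn_of_preconnected_of_frequently_eq hA (hG.analyticOnNhd hopen)
    (hset ▸ ((convex_Ioo lo hi).linear_preimage Complex.reLm).isPreconnected)
    (z₀ := (t : ℂ)) ⟨ht1, ht2.trans_le hc⟩ ?_ ⟨hs1, hs2⟩
  have htend : Filter.Tendsto (fun x : ℝ => (x : ℂ)) (nhdsWithin t {t}ᶜ)
      (nhdsWithin (t : ℂ) {(t : ℂ)}ᶜ) := by
    refine tendsto_nhdsWithin_iff.2 ⟨(Complex.continuous_ofReal.tendsto t).mono_left
      nhdsWithin_le_nhds, ?_⟩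
    filter_upwards [self_mem_nhdsWithin] with x hx
    simpa using hx
  refine htend.frequently (Filter.Eventually.frequently ?_)
  filter_upwards [nhdsWithin_le_nhds (Ioo_mem_nhds ht1 ht2)] with x hx
  rw [complexMGF_ofReal, mgf_log_abs hX h0, heq x hx.1 hx.2]

lemma mem_finiteMoments_of_le [IsProbabilityMeasure μ] {s t : ℝ} (hs : 0 ≤ s) (hst : s ≤ t)
    (ht : t ∈ finiteMoments X μ) : s ∈ finiteMoments X μ := by
  have ht : ∫⁻ ω, ENNReal.ofReal |X ω| ^ t ∂μ < ⊤ := ht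
  refine lt_of_le_of_lt (b := ∫⁻ ω, (1 + ENNReal.ofReal |X ω| ^ t) ∂μ)
    (lintegral_mono fun ω => ?_) ?_
  · rcases le_total (ENNReal.ofReal |X ω|) 1 with h | h
    · exact (ENNReal.rpow_le_one h hs).trans le_self_add
    · exact (ENNReal.rpow_le_rpow_of_exponent_le h hst).trans le_add_self
  · rw [lintegral_add_left measurable_const]
    simpa using ht

end Continuation

section Product

variable {Ω : Type*} [MeasurableSpace Ω] {μ : Measure Ω} [IsProbabilityMeasure μ] {X Y : Ω → ℝ}

lemma charFun_mul_of_indepFun (hX : AEMeasurable X μ) (hY : AEMeasurable Y μ)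
    (h : IndepFun X Y μ) (t : ℝ) :
    charFun (μ.map (fun ω => X ω * Y ω)) t = ∫ ω, charFun (μ.map X) (t * Y ω) ∂μ := by
  have hXp : IsProbabilityMeasure (μ.map X) := Measure.isProbabilityMeasure_map hX
  have hYp : IsProbabilityMeasure (μ.map Y) := Measure.isProbabilityMeasure_map hY
  have hmap := (indepFun_iff_map_prod_eq_prod_map_map hX hY).1 h
  have h1 : μ.map (fun ω => X ω * Y ω) = ((μ.map X).prod (μ.map Y)).map (fun p => p.1 * p.2) := by
    rw [← hmap, AEMeasurable.map_map_of_aemeasurable (by fun_prop) (by fun_prop)]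
    rfl
  have hI : Integrable (fun p : ℝ × ℝ => Complex.exp (t * ((p.1 * p.2 : ℝ) : ℂ) * Complex.I))
      ((μ.map X).prod (μ.map Y)) := by
    refine Integrable.of_bound (C := 1) (Continuous.aestronglyMeasurable (by fun_prop))
      (ae_of_all _ fun p => le_of_eq ?_)
    rw [← Complex.norm_exp_ofReal_mul_I (t * (p.1 * p.2))]
    push_cast
    rfl
  rw [h1, charFun_apply_real, integral_map (by fun_prop)
    (Continuous.aestronglyMeasurable (by fun_prop)), integral_prod_symm _ hI,
    ← integral_map (f := fun y => charFun (μ.map X) (t * y)) hY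
    (Measurable.aestronglyMeasurable (by fun_prop))]
  refine integral_congr_ae (ae_of_all _ fun y => ?_)
  simp only [charFun_apply_real]
  refine integral_congr_ae (ae_of_all _ fun x => ?_)
  push_cast
  ring_nf

end Product

section GenLinnik

variable {Ω : Type*} [MeasurableSpace Ω] {μ : Measure Ω} {α β : ℝ} {S V : Ω → ℝ}

lemma aemeasurable_genLinnik (hS : IsSymmetricStable α S μ) (hV : HasLaw V (genExpMeasure β) μ) :
    AEMeasurable (genLinnik α β S V) μ := by
  have h1 := hS.aemeasurable
  have h2 := hV.aemeasurable
  unfold genLinnik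
  fun_prop

lemma ae_pos_of_hasLaw_genExpMeasure (hV : HasLaw V (genExpMeasure β) μ) :
    ∀ᵐ ω ∂μ, 0 < V ω :=
  (hV.ae_iff (p := fun x => 0 < x) (measurableSet_setOfPred.1 measurableSet_Ioi)).2
    ae_pos_genExpMeasure

lemma lintegral_abs_genLinnik_rpow (hS : IsSymmetricStable α S μ)
    (hV : HasLaw V (genExpMeasure β) μ) (hSV : IndepFun S V μ) (s : ℝ) :
    ∫⁻ ω, ENNReal.ofReal |genLinnik α β S V ω| ^ s ∂μ
      = absMom (μ.map S) s * absMom (genExpMeasure β) (β / α * s) := by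
  have h1 := hS.aemeasurable
  have h2 := hV.aemeasurable
  have h3 : absMom (μ.map S) s = ∫⁻ ω, ENNReal.ofReal |S ω| ^ s ∂μ :=
    lintegral_map' (by fun_prop) h1
  have h4 : absMom (genExpMeasure β) (β / α * s) = ∫⁻ ω, ENNReal.ofReal |V ω| ^ (β / α * s) ∂μ :=
    (hV.lintegral_comp (f := fun x => ENNReal.ofReal |x| ^ (β / α * s)) (by fun_prop)).symm
  rw [h3, h4]
  refine Eq.trans ?_ (lintegral_mul_eq_lintegral_mul_lintegral_of_indepFun'' (by fun_prop)
    (by fun_prop) (hSV.comp (φ := fun x => ENNReal.ofReal |x| ^ s)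
      (ψ := fun x => ENNReal.ofReal |x| ^ (β / α * s)) (by fun_prop) (by fun_prop)))
  refine lintegral_congr_ae ?_
  filter_upwards [ae_pos_of_hasLaw_genExpMeasure hV] with ω hω
  simp only [genLinnik]
  rw [abs_mul, ENNReal.ofReal_mul (abs_nonneg _), ENNReal.mul_rpow_of_ne_top ENNReal.ofReal_ne_top
    ENNReal.ofReal_ne_top, abs_of_pos (Real.rpow_pos_of_pos hω _), abs_of_pos hω,
    ENNReal.rpow_mul, ENNReal.ofReal_rpow_of_pos hω]

variable [IsProbabilityMeasure μ]

lemma charFun_genLinnik (hα : 0 < α) (hβ : 0 < β) (hS : IsSymmetricStable α S μ)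
    (hV : HasLaw V (genExpMeasure β) μ) (hSV : IndepFun S V μ) (t : ℝ) :
    charFun (μ.map (genLinnik α β S V)) t = ((1 / (1 + |t| ^ α) ^ (1 / β) : ℝ) : ℂ) := by
  have h1 := hS.aemeasurable
  have h2 := hV.aemeasurable
  have h := charFun_mul_of_indepFun h1 (Y := fun ω => V ω ^ (β / α)) (by fun_prop)
    (hSV.comp (φ := id) (ψ := fun x => x ^ (β / α)) measurable_id (by fun_prop)) t
  refine h.trans ?_
  rw [← integral_exp_neg_mul_rpow_genExpMeasure hβ (Real.rpow_nonneg (abs_nonneg t) α),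
    ← hV.integral_comp (f := fun x => Real.exp (-(|t| ^ α * x ^ β)))
      (Measurable.aestronglyMeasurable (by fun_prop)), ← integral_complex_ofReal]
  refine integral_congr_ae ?_
  filter_upwards [ae_pos_of_hasLaw_genExpMeasure hV] with ω hω
  rw [hS.charFun_eq, abs_mul, Real.mul_rpow (abs_nonneg _) (abs_nonneg _),
    abs_of_pos (Real.rpow_pos_of_pos hω _), ← Real.rpow_mul hω.le, div_mul_cancel₀ _ hα.ne']
  rfl

lemma mem_finiteMoments_genLinnik (hα : 0 < α) (hβ : 0 < β)
    (hS : IsSymmetricStable α S μ) (hV : HasLaw V (genExpMeasure β) μ) (hSV : IndepFun S V μ)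
    {s : ℝ} (h1 : -(min (α / β) 1) < s) (h2 : s < α) :
    s ∈ finiteMoments (genLinnik α β S V) μ := by
  have hP : IsProbabilityMeasure (μ.map S) := Measure.isProbabilityMeasure_map hS.aemeasurable
  have h3 : -1 < s := by linarith [min_le_right (α / β) 1]
  have h4 : -(α / β) < s := by linarith [min_le_left (α / β) 1]
  have h5 : -1 < β / α * s := by
    rw [← neg_div, div_lt_iff₀ hβ] at h4
    rw [div_mul_eq_mul_div, lt_div_iff₀ hα]
    linarith
  change ∫⁻ ω, ENNReal.ofReal |genLinnik α β S V ω| ^ s ∂μ < ⊤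
  rw [lintegral_abs_genLinnik_rpow hS hV hSV, absMom_genExpMeasure hβ h5]
  exact ENNReal.mul_lt_top (absMom_stable_lt_top hα hS.charFun_eq h3 h2) ENNReal.ofReal_lt_top

lemma mem_finiteMoments_genLinnik_two (hβ : 0 < β)
    (hS : IsSymmetricStable 2 S μ) (hV : HasLaw V (genExpMeasure β) μ) (hSV : IndepFun S V μ)
    {s : ℝ} (h1 : 0 < s) :
    s ∈ finiteMoments (genLinnik 2 β S V) μ := by
  have hP : IsProbabilityMeasure (μ.map S) := Measure.isProbabilityMeasure_map hS.aemeasurable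
  have h5 : -1 < β / 2 * s := by
    have : 0 < β / 2 * s := by positivity
    linarith
  change ∫⁻ ω, ENNReal.ofReal |genLinnik 2 β S V ω| ^ s ∂μ < ⊤
  rw [lintegral_abs_genLinnik_rpow hS hV hSV, absMom_genExpMeasure hβ h5]
  exact ENNReal.mul_lt_top (absMom_stable_two_lt_top hS.charFun_eq (by linarith))
    ENNReal.ofReal_lt_top

lemma notMem_finiteMoments_genLinnik_of_le (hα : 0 < α) (hβ : 0 < β)
    (hS : IsSymmetricStable α S μ) (hV : HasLaw V (genExpMeasure β) μ) (hSV : IndepFun S V μ)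
    {s : ℝ} (h1 : s ≤ -(min (α / β) 1)) :
    s ∉ finiteMoments (genLinnik α β S V) μ := by
  have hP : IsProbabilityMeasure (μ.map S) := Measure.isProbabilityMeasure_map hS.aemeasurable
  have h0 : 0 < min (α / β) 1 := lt_min (by positivity) one_pos
  change ¬ ∫⁻ ω, ENNReal.ofReal |genLinnik α β S V ω| ^ s ∂μ < ⊤
  rw [lintegral_abs_genLinnik_rpow hS hV hSV, not_lt, top_le_iff]
  rcases le_total (α / β) 1 with h | h
  · rw [min_eq_left h] at h1
    have hs : s < 0 := by linarith [div_pos hα hβ]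
    rw [absMom_genExpMeasure_eq_top hβ, ENNReal.mul_top (absMom_ne_zero_of_neg hs)]
    rw [← neg_div, le_div_iff₀ hβ] at h1
    rw [div_mul_eq_mul_div, div_le_iff₀ hα]
    linarith
  · rw [min_eq_right h] at h1
    rw [absMom_stable_eq_top_of_le_neg_one hα hS.charFun_eq h1,
      ENNReal.top_mul (absMom_genExpMeasure_ne_zero hβ _)]

lemma notMem_finiteMoments_genLinnik_of_ge (hα : 0 < α) (hα2 : α < 2) (hβ : 0 < β)
    (hS : IsSymmetricStable α S μ) (hV : HasLaw V (genExpMeasure β) μ) (hSV : IndepFun S V μ)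
    {s : ℝ} (h1 : α ≤ s) :
    s ∉ finiteMoments (genLinnik α β S V) μ := by
  have hP : IsProbabilityMeasure (μ.map S) := Measure.isProbabilityMeasure_map hS.aemeasurable
  intro hs
  have hα' : ∫⁻ ω, ENNReal.ofReal |genLinnik α β S V ω| ^ α ∂μ < ⊤ :=
    mem_finiteMoments_of_le hα.le h1 hs
  rw [lintegral_abs_genLinnik_rpow hS hV hSV, absMom_stable_eq_top hα hS.charFun_eq le_rfl hα2,
      ENNReal.top_mul (absMom_genExpMeasure_ne_zero hβ _)] at hα'
  exact lt_irrefl _ hα'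

lemma rhoPlus_genLinnik (hα : 0 < α) (hα2 : α ≤ 2) (hβ : 0 < β)
    (hS : IsSymmetricStable α S μ) (hV : HasLaw V (genExpMeasure β) μ) (hSV : IndepFun S V μ) :
    rhoPlus (genLinnik α β S V) μ = if α = 2 then (⊤ : EReal) else ((α : ℝ) : EReal) := by
  unfold rhoPlus
  split_ifs with h
  · subst h
    refine EReal.eq_top_iff_forall_lt _ |>.2 fun y => ?_
    have hy : 0 < max y 0 + 1 := by positivity
    refine lt_of_lt_of_le ?_ (le_iSup₂_of_le (max y 0 + 1)
      (mem_finiteMoments_genLinnik_two hβ hS hV hSV hy) le_rfl)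
    exact_mod_cast (le_max_left y 0).trans_lt (lt_add_one _)
  · refine le_antisymm (iSup₂_le fun s hs => ?_) (le_of_forall_lt fun c hc => ?_)
    · by_contra hlt
      rw [not_le, EReal.coe_lt_coe_iff] at hlt
      exact notMem_finiteMoments_genLinnik_of_ge hα (lt_of_le_of_ne hα2 h) hβ hS hV hSV hlt.le hs
    · obtain ⟨y, hy1, hy2⟩ := EReal.lt_iff_exists_real_btwn.1
        (max_lt hc (EReal.coe_lt_coe_iff.2 hα) : max c ((0 : ℝ) : EReal) < α)
      have hy0 : 0 < y := EReal.coe_lt_coe_iff.1 ((le_max_right _ _).trans_lt hy1)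
      refine lt_of_lt_of_le ((le_max_left _ _).trans_lt hy1) (le_iSup₂_of_le y
        (mem_finiteMoments_genLinnik hα hβ hS hV hSV ?_ (EReal.coe_lt_coe_iff.1 hy2)) le_rfl)
      have : 0 < min (α / β) 1 := lt_min (by positivity) one_pos
      linarith

lemma rhoMinus_genLinnik (hα : 0 < α) (hβ : 0 < β)
    (hS : IsSymmetricStable α S μ) (hV : HasLaw V (genExpMeasure β) μ) (hSV : IndepFun S V μ) :
    rhoMinus (genLinnik α β S V) μ = ((-(min (α / β) 1) : ℝ) : EReal) := by
  have h0 : 0 < min (α / β) 1 := lt_min (by positivity) one_pos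
  unfold rhoMinus
  refine le_antisymm (le_of_forall_gt fun c hc => ?_) (le_iInf₂ fun s hs => ?_)
  · obtain ⟨y, hy1, hy2⟩ := EReal.lt_iff_exists_real_btwn.1
      (lt_min hc (EReal.coe_lt_coe_iff.2 (neg_lt_zero.2 h0)) :
        ((-(min (α / β) 1) : ℝ) : EReal) < min c ((0 : ℝ) : EReal))
    have hy0 : y < 0 := EReal.coe_lt_coe_iff.1 (hy2.trans_le (min_le_right _ _))
    exact lt_of_le_of_lt (iInf₂_le_of_le y
      (mem_finiteMoments_genLinnik hα hβ hS hV hSV (EReal.coe_lt_coe_iff.1 hy1) (hy0.trans hα))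
      le_rfl) (hy2.trans_le (min_le_left _ _))
  · by_contra hlt
    rw [not_le, EReal.coe_lt_coe_iff] at hlt
    exact notMem_finiteMoments_genLinnik_of_le hα hβ hS hV hSV hlt.le hs

/-- The Gamma quotient of the generalized Linnik variable. -/
noncomputable def genLinnikMoment (α β : ℝ) (s : ℂ) : ℂ :=
  (2 : ℂ) ^ s * (Complex.Gamma ((s + 1) / 2) * Complex.Gamma (1 - s / α)
    * Complex.Gamma (s / α + 1 / β))
    / ((Real.sqrt Real.pi : ℂ) * Complex.Gamma (1 / β) * Complex.Gamma (1 - s / 2))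

lemma ne_neg_natCast_of_re_pos {z : ℂ} (hz : 0 < z.re) (m : ℕ) : z ≠ -(m : ℂ) := by
  intro h
  rw [h] at hz
  simp only [Complex.neg_re, Complex.natCast_re] at hz
  linarith [(Nat.cast_nonneg m : (0 : ℝ) ≤ m)]

lemma re_args_pos (hα : 0 < α) (hα2 : α ≤ 2) (hβ : 0 < β) {s : ℂ}
    (h1 : -(min (α / β) 1) < s.re) (h2 : s.re < α) :
    0 < ((s + 1) / 2).re ∧ 0 < (1 - s / α).re ∧ 0 < (s / α + 1 / β).re ∧ 0 < (1 - s / 2).re := by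
  have h3 : -1 < s.re := by linarith [min_le_right (α / β) 1]
  have h4 : -(α / β) < s.re := by linarith [min_le_left (α / β) 1]
  have e1 : ((s + 1) / 2).re = (s.re + 1) / 2 := by
    rw [show (2 : ℂ) = ((2 : ℝ) : ℂ) by norm_num, Complex.div_ofReal_re]; simp
  have e2 : (1 - s / α).re = 1 - s.re / α := by simp [Complex.div_ofReal_re]
  have e3 : (s / α + 1 / β).re = s.re / α + 1 / β := by
    rw [Complex.add_re, Complex.div_ofReal_re, Complex.div_ofReal_re]; simp
  have e4 : (1 - s / 2).re = 1 - s.re / 2 := by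
    rw [show (2 : ℂ) = ((2 : ℝ) : ℂ) by norm_num, Complex.sub_re, Complex.div_ofReal_re]; simp
  refine ⟨by rw [e1]; linarith, ?_, ?_, by rw [e4]; linarith⟩
  · rw [e2, sub_pos, div_lt_one hα]; exact h2
  · rw [e3, div_add_div _ _ hα.ne' hβ.ne']
    rw [← neg_div, div_lt_iff₀ hβ] at h4
    exact div_pos (by linarith) (by positivity)

lemma differentiableOn_genLinnikMoment (hα : 0 < α) (hα2 : α ≤ 2) (hβ : 0 < β) :
    DifferentiableOn ℂ (genLinnikMoment α β) {z | -(min (α / β) 1) < z.re ∧ z.re < α} := by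
  intro s hs
  obtain ⟨p1, p2, p3, p4⟩ := re_args_pos hα hα2 hβ hs.1 hs.2
  have d1 := (Complex.differentiableAt_Gamma _ (ne_neg_natCast_of_re_pos p1)).comp (f := fun s : ℂ =>
    (s + 1) / 2) s (by fun_prop)
  have d2 := (Complex.differentiableAt_Gamma _ (ne_neg_natCast_of_re_pos p2)).comp (f := fun s : ℂ =>
    1 - s / α) s (by fun_prop)
  have d3 := (Complex.differentiableAt_Gamma _ (ne_neg_natCast_of_re_pos p3)).comp (f := fun s : ℂ =>
    s / α + 1 / β) s (by fun_prop)
  have d4 := (Complex.differentiableAt_Gamma _ (ne_neg_natCast_of_re_pos p4)).comp (f := fun s : ℂ =>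
    1 - s / 2) s (by fun_prop)
  have hb : Complex.Gamma (1 / β) ≠ 0 := Complex.Gamma_ne_zero_of_re_pos (by
    rw [Complex.div_ofReal_re]; simpa using hβ)
  refine DifferentiableAt.differentiableWithinAt (DifferentiableAt.div
    ((DifferentiableAt.const_cpow differentiableAt_id (Or.inl two_ne_zero)).mul ((d1.mul d2).mul d3))
    (d4.const_mul _) ?_)
  refine mul_ne_zero (mul_ne_zero ?_ hb) (Complex.Gamma_ne_zero_of_re_pos p4)
  exact_mod_cast (Real.sqrt_pos.2 Real.pi_pos).ne'

lemma absMoment_genLinnik (hα : 0 < α) (hα2 : α ≤ 2) (hβ : 0 < β)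
    (hS : IsSymmetricStable α S μ) (hV : HasLaw V (genExpMeasure β) μ) (hSV : IndepFun S V μ)
    {s : ℂ} (h1 : -(min (α / β) 1) < s.re) (h2 : s.re < α) :
    HasAbsMoment (genLinnik α β S V) μ s ∧
      absMoment (genLinnik α β S V) μ s = genLinnikMoment α β s := by
  have hP : IsProbabilityMeasure (μ.map S) := Measure.isProbabilityMeasure_map hS.aemeasurable
  have h0 : 0 < min (α / β) 1 := lt_min (by positivity) one_pos
  have hX := aemeasurable_genLinnik hS hV
  have hne : ∀ᵐ ω ∂μ, genLinnik α β S V ω ≠ 0 :=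
    ae_ne_zero_of_mem_finiteMoments hX (s := -(min (α / β) 1 / 2)) (by linarith)
      (mem_finiteMoments_genLinnik hα hβ hS hV hSV (by linarith) (by linarith))
  refine ⟨hasAbsMoment_of_mem_finiteMoments hX hne
    (mem_finiteMoments_genLinnik hα hβ hS hV hSV h1 h2), ?_⟩
  refine absMoment_eq_of_analytic hX hne (c := 0) (neg_lt_zero.2 h0) hα.le
    (fun s hs1 hs2 => mem_finiteMoments_genLinnik hα hβ hS hV hSV hs1 hs2)
    (differentiableOn_genLinnikMoment hα hα2 hβ) (fun s hs1 hs2 => ?_) h1 h2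
  obtain ⟨p1, p2, p3, p4⟩ := re_args_pos hα hα2 hβ (s := (s : ℂ)) hs1 (hs2.trans hα)
  have e1 : ((s : ℂ) + 1) / 2 = (((1 + s) / 2 : ℝ) : ℂ) := by push_cast; ring
  have e2 : 1 - (s : ℂ) / α = ((1 - s / α : ℝ) : ℂ) := by push_cast; ring
  have e3 : (s : ℂ) / α + 1 / β = (((β / α * s + 1) / β : ℝ) : ℂ) := by
    have : (β : ℂ) ≠ 0 := by exact_mod_cast hβ.ne'
    push_cast; field_simp
  have e4 : 1 - (s : ℂ) / 2 = ((1 - s / 2 : ℝ) : ℂ) := by push_cast; ring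
  have e5 : (1 : ℂ) / β = ((1 / β : ℝ) : ℂ) := by push_cast; ring
  have e6 : (2 : ℂ) ^ (s : ℂ) = ((2 ^ s : ℝ) : ℂ) := by
    rw [Complex.ofReal_cpow (by norm_num)]; norm_num
  rw [e1, Complex.ofReal_re] at p1
  rw [e2, Complex.ofReal_re] at p2
  rw [e3, Complex.ofReal_re] at p3
  rw [e4, Complex.ofReal_re] at p4
  have q1 := Real.Gamma_pos_of_pos p1
  have q2 := Real.Gamma_pos_of_pos p2
  have q3 := Real.Gamma_pos_of_pos p3
  have q4 := Real.Gamma_pos_of_pos p4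
  have q5 : 0 < Real.Gamma (1 / β) := Real.Gamma_pos_of_pos (by positivity)
  have h3 : -1 < s := by linarith [min_le_right (α / β) 1]
  have h5 : -1 < β / α * s := by
    have := (div_pos_iff_of_pos_right hβ).1 p3
    linarith
  rw [lintegral_abs_genLinnik_rpow hS hV hSV, absMom_genExpMeasure hβ h5,
    absMom_stable_of_neg hα hS.charFun_eq h3 hs2, ENNReal.toReal_mul,
    ENNReal.toReal_ofReal (by positivity), ENNReal.toReal_ofReal (by positivity)]
  unfold genLinnikMoment
  rw [e3, e5, e6, e1, e2, e4]
  simp only [Complex.Gamma_ofReal]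
  push_cast
  ring

end GenLinnik

section PositiveStable

lemma lintegral_mul_rpow_mul_exp_neg {a b : ℝ} (ha : 0 < a) (hb : 0 < b) :
    ∫⁻ w in Set.Ioi (0 : ℝ), ENNReal.ofReal (a * w ^ (a - 1) * Real.exp (-b * w ^ a))
      = ENNReal.ofReal (1 / b) := by
  have h := integral_rpow_mul_exp_neg_mul_rpow ha (q := a - 1) (by linarith) hb
  have h2 : 1 / b = ∫ w in Set.Ioi (0 : ℝ), a * w ^ (a - 1) * Real.exp (-b * w ^ a) := by
    simp_rw [mul_assoc]
    rw [integral_const_mul, h, sub_add_cancel, neg_div, div_self ha.ne', Real.Gamma_one,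
      Real.rpow_neg_one]
    field_simp
  rw [h2, ofReal_integral_eq_lintegral_ofReal]
  · simp_rw [mul_assoc]
    exact (integrableOn_rpow_mul_exp_neg_mul_rpow (by linarith) ha hb).const_mul a
  · filter_upwards [ae_restrict_mem measurableSet_Ioi] with w hw
    have := Real.rpow_nonneg (le_of_lt hw) (a - 1)
    simp only [Pi.zero_apply]
    positivity

variable {Ω : Type*} [MeasurableSpace Ω] {μ : Measure Ω} [IsProbabilityMeasure μ] {a : ℝ}
  {T T' : Ω → ℝ}

lemma IsPositiveStable.neg_mem_interior (hT : IsPositiveStable a T μ) {w : ℝ} (hw : 0 < w) :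
    -w ∈ interior (integrableExpSet T μ) := by
  refine interior_maximal (t := Set.Iio 0) (fun t ht => ?_) isOpen_Iio (Set.mem_Iio.2 (neg_lt_zero.2 hw))
  have hm := hT.aemeasurable
  refine Integrable.of_bound (C := 1) (AEMeasurable.aestronglyMeasurable (by fun_prop)) ?_
  filter_upwards [hT.pos] with ω hω
  rw [Real.norm_of_nonneg (Real.exp_nonneg _), Real.exp_le_one_iff]
  exact (mul_neg_of_neg_of_pos ht hω).le

lemma IsPositiveStable.lintegral_exp (hT : IsPositiveStable a T μ) {w : ℝ} (hw : 0 < w) :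
    ∫⁻ ω, ENNReal.ofReal (Real.exp (-(w * T ω))) ∂μ = ENNReal.ofReal (Real.exp (-w ^ a)) := by
  rw [← hT.laplace_eq w hw, ofReal_integral_eq_lintegral_ofReal _
    (ae_of_all _ fun ω => Real.exp_nonneg _)]
  simpa [integrableExpSet] using! interior_subset (hT.neg_mem_interior hw)

lemma IsPositiveStable.lintegral_mul_exp (hT : IsPositiveStable a T μ) {w : ℝ} (hw : 0 < w) :
    ∫⁻ ω, ENNReal.ofReal (T ω * Real.exp (-(w * T ω))) ∂μ
      = ENNReal.ofReal (a * w ^ (a - 1) * Real.exp (-w ^ a)) := by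
  have hi := hT.neg_mem_interior hw
  have h1 := hasDerivAt_mgf hi
  have h2 : HasDerivAt (mgf T μ) (a * w ^ (a - 1) * Real.exp (-w ^ a)) (-w) := by
    have h3 : HasDerivAt (fun t : ℝ => Real.exp (-(-t) ^ a))
        (a * w ^ (a - 1) * Real.exp (-w ^ a)) (-w) := by
      have h4 := ((hasDerivAt_neg (-w)).rpow_const (p := a) (Or.inl (by simp [hw.ne']))).neg.exp
      convert! h4 using 1
      simp only [Pi.neg_apply, neg_neg]
      ring
    refine h3.congr_of_eventuallyEq ?_
    filter_upwards [Iio_mem_nhds (neg_lt_zero.2 hw)] with t ht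
    rw [← hT.laplace_eq (-t) (neg_pos.2 ht)]
    simp [mgf]
  rw [← h1.unique h2, ofReal_integral_eq_lintegral_ofReal]
  · simp
  · simpa using integrable_pow_mul_exp_of_mem_interior_integrableExpSet hi 1
  · filter_upwards [hT.pos] with ω hω
    exact mul_nonneg hω.le (Real.exp_nonneg _)

/-- The generalized Stieltjes-type transform of the Lamperti variable. -/
lemma integral_one_div_one_add_lamperti (ha : 0 < a) (hT : IsPositiveStable a T μ)
    (hT' : IsPositiveStable a T' μ) (h : IndepFun T T' μ) {c : ℝ} (hc : 0 < c) :
    ∫ ω, 1 / (1 + c * lamperti T T' ω) ∂μ = 1 / (1 + c ^ a) := by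
  have hm := hT.aemeasurable
  have hm' := hT'.aemeasurable
  have hca : 0 < c ^ a := Real.rpow_pos_of_pos hc a
  have hlam : ∫⁻ ω, ENNReal.ofReal (1 / (1 + c * lamperti T T' ω)) ∂μ
      = ENNReal.ofReal (1 / (1 + c ^ a)) := by
    calc ∫⁻ ω, ENNReal.ofReal (1 / (1 + c * lamperti T T' ω)) ∂μ
        = ∫⁻ ω, (∫⁻ w in Set.Ioi (0 : ℝ), ENNReal.ofReal (Real.exp (-(w * c * T ω)))
            * ENNReal.ofReal (T' ω * Real.exp (-(w * T' ω)))) ∂μ := by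
          refine lintegral_congr_ae ?_
          filter_upwards [hT.pos, hT'.pos] with ω h1 h2
          have h3 := lintegral_mul_rpow_mul_exp_neg one_pos (b := T' ω + c * T ω) (by positivity)
          have h4 : 1 / (1 + c * lamperti T T' ω) = T' ω * (1 / (T' ω + c * T ω)) := by
            unfold lamperti
            field_simp
          rw [h4, ENNReal.ofReal_mul h2.le, ← h3,
            ← lintegral_const_mul' _ _ ENNReal.ofReal_ne_top]
          refine lintegral_congr fun w => ?_
          rw [← ENNReal.ofReal_mul h2.le, ← ENNReal.ofReal_mul (Real.exp_nonneg _)]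
          congr 1
          rw [mul_left_comm (Real.exp _), ← Real.exp_add]
          simp only [sub_self, Real.rpow_zero, Real.rpow_one, one_mul]
          ring_nf
      _ = ∫⁻ w in Set.Ioi (0 : ℝ), ∫⁻ ω, ENNReal.ofReal (Real.exp (-(w * c * T ω)))
            * ENNReal.ofReal (T' ω * Real.exp (-(w * T' ω))) ∂μ :=
          lintegral_lintegral_swap (by
            have e1 : AEMeasurable (fun p : Ω × ℝ => T p.1)
              (μ.prod (volume.restrict (Set.Ioi (0 : ℝ)))) := hm.comp_fst
            have e2 : AEMeasurable (fun p : Ω × ℝ => T' p.1)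
              (μ.prod (volume.restrict (Set.Ioi (0 : ℝ)))) := hm'.comp_fst
            simp only [Function.uncurry_def]
            fun_prop)
      _ = ∫⁻ w in Set.Ioi (0 : ℝ),
            ENNReal.ofReal (a * w ^ (a - 1) * Real.exp (-(1 + c ^ a) * w ^ a)) := by
          refine setLIntegral_congr_fun measurableSet_Ioi fun w hw => ?_
          have hw : 0 < w := hw
          refine (lintegral_mul_eq_lintegral_mul_lintegral_of_indepFun'' (by fun_prop)
            (by fun_prop) (h.comp (φ := fun x => ENNReal.ofReal (Real.exp (-(w * c * x))))
            (ψ := fun x => ENNReal.ofReal (x * Real.exp (-(w * x)))) (by fun_prop)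
            (by fun_prop))).trans ?_
          simp only [Function.comp_def]
          rw [hT.lintegral_exp (mul_pos hw hc), hT'.lintegral_mul_exp hw,
            ← ENNReal.ofReal_mul (Real.exp_nonneg _), Real.mul_rpow hw.le hc.le,
            mul_left_comm, ← Real.exp_add]
          ring_nf
      _ = _ := lintegral_mul_rpow_mul_exp_neg ha (by positivity)
  rw [integral_eq_lintegral_of_nonneg_ae, hlam, ENNReal.toReal_ofReal (by positivity)]
  · filter_upwards [hT.pos, hT'.pos] with ω h1 h2
    have : 0 < lamperti T T' ω := div_pos h1 h2
    simp only [Pi.zero_apply]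
    positivity
  · unfold lamperti
    exact AEMeasurable.aestronglyMeasurable (by fun_prop)

end PositiveStable

section Linnik

lemma linnik_eq_genLinnik {Ω : Type*} (α : ℝ) (S V : Ω → ℝ) :
    linnik α S V = genLinnik α 1 S V := rfl

variable {Ω : Type*} [MeasurableSpace Ω] {μ : Measure Ω} {α : ℝ} {S V : Ω → ℝ}

lemma aemeasurable_linnik (hS : IsSymmetricStable α S μ) (hV : HasLaw V (expMeasure 1) μ) :
    AEMeasurable (linnik α S V) μ :=
  aemeasurable_genLinnik (β := 1) hS (expMeasure_one ▸ hV)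

variable [IsProbabilityMeasure μ]

lemma charFun_linnik (hα : 0 < α) (hS : IsSymmetricStable α S μ)
    (hV : HasLaw V (expMeasure 1) μ) (hSV : IndepFun S V μ) (t : ℝ) :
    charFun (μ.map (linnik α S V)) t = ((1 / (1 + |t| ^ α) : ℝ) : ℂ) := by
  rw [linnik_eq_genLinnik, charFun_genLinnik hα one_pos hS (expMeasure_one ▸ hV) hSV, div_one,
    Real.rpow_one]

lemma identDistrib_linnik_mul_lamperti {Ω' : Type*} [MeasurableSpace Ω'] {ν : Measure Ω'}
    [IsProbabilityMeasure ν] {β : ℝ} {S' V' T T' : Ω' → ℝ} (hα : 0 < α) (hαβ : α < β)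
    (hS : IsSymmetricStable α S μ) (hV : HasLaw V (expMeasure 1) μ) (hSV : IndepFun S V μ)
    (hS' : IsSymmetricStable β S' ν) (hV' : HasLaw V' (expMeasure 1) ν)
    (hSV' : IndepFun S' V' ν) (hT : IsPositiveStable (α / β) T ν)
    (hT' : IsPositiveStable (α / β) T' ν) (hTT' : IndepFun T T' ν)
    (hind : IndepFun (linnik β S' V') (fun ω => lamperti T T' ω ^ (1 / β)) ν) :
    IdentDistrib (linnik α S V)
      (fun ω => linnik β S' V' ω * lamperti T T' ω ^ (1 / β)) μ ν := by
  have hβ : 0 < β := hα.trans hαβ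
  have hX := aemeasurable_linnik hS hV
  have hX' := aemeasurable_linnik hS' hV'
  have hL : AEMeasurable (fun ω => lamperti T T' ω ^ (1 / β)) ν := by
    have h1 := hT.aemeasurable
    have h2 := hT'.aemeasurable
    unfold lamperti
    fun_prop
  refine ⟨hX, hX'.mul hL, ?_⟩
  have := Measure.isProbabilityMeasure_map hX
  have := Measure.isProbabilityMeasure_map (hX'.mul hL)
  refine Measure.ext_of_charFun (funext fun t => ?_)
  refine Eq.trans ?_ (charFun_mul_of_indepFun hX' hL hind t).symm
  rw [charFun_linnik hα hS hV hSV]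
  simp_rw [charFun_linnik hβ hS' hV' hSV']
  rw [integral_complex_ofReal]
  congr 1
  rcases eq_or_ne t 0 with rfl | ht
  · simp [Real.zero_rpow hα.ne', Real.zero_rpow hβ.ne']
  · have h := integral_one_div_one_add_lamperti (div_pos hα hβ) hT hT' hTT'
      (Real.rpow_pos_of_pos (abs_pos.2 ht) β)
    rw [← Real.rpow_mul (abs_nonneg t), mul_div_cancel₀ _ hβ.ne'] at h
    rw [← h]
    refine integral_congr_ae ?_
    filter_upwards [hT.pos, hT'.pos] with ω h1 h2
    have hl : 0 < lamperti T T' ω := div_pos h1 h2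
    rw [abs_mul, Real.mul_rpow (abs_nonneg _) (abs_nonneg _),
      abs_of_pos (Real.rpow_pos_of_pos hl _), ← Real.rpow_mul hl.le, one_div_mul_cancel hβ.ne',
      Real.rpow_one]

end Linnik

section GammaType

variable {Ω : Type*} [MeasurableSpace Ω] {μ : Measure Ω} [IsProbabilityMeasure μ] {α β : ℝ}
  {S V : Ω → ℝ}

/-- The Gamma quotient of the generalized Linnik variable, with its data. -/
noncomputable def genLinnikQuotient (α β : ℝ) (hα : α ≠ 0) : GammaQuotient where
  C := (√Real.pi * Real.Gamma (1 / β))⁻¹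
  D := 2
  num := [(1 / 2, 1 / 2), (1 / α, 1 / β), (-1 / α, 1)]
  den := [(-1 / 2, 1)]
  D_pos := two_pos
  num_ne := by simp [hα]
  den_ne := by simp

lemma eval_genLinnikQuotient (hα : α ≠ 0) (s : ℂ) :
    (genLinnikQuotient α β hα).eval s = genLinnikMoment α β s := by
  have e1 : ((1 / 2 : ℝ) : ℂ) * s + ((1 / 2 : ℝ) : ℂ) = (s + 1) / 2 := by push_cast; ring
  have e2 : ((1 / α : ℝ) : ℂ) * s + ((1 / β : ℝ) : ℂ) = s / α + 1 / β := by push_cast; ring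
  have e3 : ((-1 / α : ℝ) : ℂ) * s + ((1 : ℝ) : ℂ) = 1 - s / α := by push_cast; ring
  have e4 : ((-1 / 2 : ℝ) : ℂ) * s + ((1 : ℝ) : ℂ) = 1 - s / 2 := by push_cast; ring
  simp only [GammaQuotient.eval, genLinnikQuotient, genLinnikMoment, List.map_cons, List.map_nil,
    List.prod_cons, List.prod_nil, mul_one]
  rw [e1, e2, e3, e4]
  push_cast
  rw [← Complex.Gamma_ofReal]
  push_cast
  ring

lemma hasGammaMoments_genLinnik (hα : 0 < α) (hα2 : α ≤ 2) (hβ : 0 < β)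
    (hS : IsSymmetricStable α S μ) (hV : HasLaw V (genExpMeasure β) μ) (hSV : IndepFun S V μ) :
    HasGammaMoments (genLinnikQuotient α β hα.ne') (genLinnik α β S V) μ (-(min (α / β) 1)) α := by
  have h0 : 0 < min (α / β) 1 := lt_min (by positivity) one_pos
  refine ⟨by linarith, fun s h1 h2 => ⟨fun p hp m => ?_, ?_⟩⟩
  · obtain ⟨p1, p2, p3, p4⟩ := re_args_pos hα hα2 hβ h1 h2
    refine ne_neg_natCast_of_re_pos ?_ m
    simp only [genLinnikQuotient, List.cons_append, List.nil_append, List.mem_cons,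
      List.not_mem_nil, or_false] at hp
    rcases hp with rfl | rfl | rfl | rfl
    · convert! p1 using 2; push_cast; ring
    · convert! p3 using 2; push_cast; ring
    · convert! p2 using 2; push_cast; ring
    · convert! p4 using 2; push_cast; ring
  · rw [eval_genLinnikQuotient]
    exact absMoment_genLinnik hα hα2 hβ hS hV hSV h1 h2

lemma gam_genLinnikQuotient (hα : 0 < α) : (genLinnikQuotient α β hα.ne').gam = 2 / α := by
  simp only [GammaQuotient.gam, genLinnikQuotient, List.map_cons, List.map_nil, List.sum_cons,
    List.sum_nil, neg_div, abs_neg, abs_of_pos (one_div_pos.2 hα), abs_of_pos (one_half_pos (α := ℝ))]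
  ring

lemma gam'_genLinnikQuotient (hα : α ≠ 0) : (genLinnikQuotient α β hα).gam' = 1 := by
  simp only [GammaQuotient.gam', genLinnikQuotient, List.map_cons, List.map_nil, List.sum_cons,
    List.sum_nil]
  ring

lemma del_genLinnikQuotient (hα : α ≠ 0) : (genLinnikQuotient α β hα).del = 1 / β - 1 / 2 := by
  simp only [GammaQuotient.del, genLinnikQuotient, List.map_cons, List.map_nil, List.sum_cons,
    List.sum_nil, List.length_cons, List.length_nil]
  push_cast
  ring

lemma kap_genLinnikQuotient (hα : α ≠ 0) : (genLinnikQuotient α β hα).kap = 0 := by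
  simp only [GammaQuotient.kap, genLinnikQuotient, List.map_cons, List.map_nil, List.sum_cons,
    List.sum_nil, neg_div, Real.log_neg_eq_log, Real.log_abs, one_div, Real.log_inv]
  ring

lemma C₁_genLinnikQuotient_one (hα : 0 < α) :
    (genLinnikQuotient α 1 hα.ne').C₁ = 2 * √(2 * Real.pi) / α := by
  have hpi := Real.pi_pos
  have h1 : (1 - 1 / 2 : ℝ) = 1 / 2 := by norm_num
  have h2 : ((3 : ℝ) - 1) / 2 = 1 := by norm_num
  simp only [GammaQuotient.C₁, genLinnikQuotient, List.map_cons, List.map_nil, List.prod_cons,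
    List.prod_nil, List.length_cons, List.length_nil, neg_div, abs_neg, div_one, Real.Gamma_one,
    abs_of_pos (one_div_pos.2 hα), abs_of_pos (one_half_pos (α := ℝ)), sub_self, Real.rpow_zero,
    mul_one, one_mul, h1]
  push_cast
  rw [h2, Real.rpow_one,
    ← Real.sqrt_eq_rpow, ← Real.sqrt_eq_rpow, Real.mul_self_sqrt (by positivity),
    abs_of_pos (by positivity), Real.sqrt_mul (by norm_num), Real.sqrt_div (by norm_num),
    Real.sqrt_one]
  field_simp
  rw [Real.sq_sqrt hpi.le]

end GammaType

end LinnikDistribution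

theorem mainTheorem8 :
    -- the Linnik variable `X_α = S_α V_1^{1/α}`
    (∀ (Ω : Type*) [MeasurableSpace Ω] (μ : Measure Ω) [IsProbabilityMeasure μ]
        (α : ℝ) (S V : Ω → ℝ),
      0 < α → α ≤ 2 →
      LinnikDistribution.IsSymmetricStable α S μ → HasLaw V (expMeasure 1) μ → IndepFun S V μ →
      (∀ t : ℝ, charFun (μ.map (LinnikDistribution.linnik α S V)) t
          = ((1 / (1 + |t| ^ α) : ℝ) : ℂ)) ∧
      (∀ s : ℂ, -(min α 1) < s.re → s.re < α →
        LinnikDistribution.HasAbsMoment (LinnikDistribution.linnik α S V) μ s ∧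
        LinnikDistribution.absMoment (LinnikDistribution.linnik α S V) μ s =
          (2 : ℂ) ^ s * (Complex.Gamma ((1 + s) / 2) * Complex.Gamma (1 + s / α)
              * Complex.Gamma (1 - s / α))
            / ((Real.sqrt Real.pi : ℂ) * Complex.Gamma (1 - s / 2))) ∧
      LinnikDistribution.rhoPlus (LinnikDistribution.linnik α S V) μ
        = (if α = 2 then (⊤ : EReal) else ((α : ℝ) : EReal)) ∧
      LinnikDistribution.rhoMinus (LinnikDistribution.linnik α S V) μ
        = ((-(min α 1) : ℝ) : EReal) ∧
      (∃ g : LinnikDistribution.GammaQuotient,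
        LinnikDistribution.HasGammaMoments g (LinnikDistribution.linnik α S V) μ
          (-(min α 1)) α ∧
        g.gam = 2 / α ∧ g.gam' = 1 ∧ g.del = 1 / 2 ∧ g.kap = 0 ∧
        g.C₁ = 2 * Real.sqrt (2 * Real.pi) / α)) ∧
    -- the generalized Linnik variable `X_{α,β} = S_α V_β^{β/α}`
    (∀ (Ω : Type*) [MeasurableSpace Ω] (μ : Measure Ω) [IsProbabilityMeasure μ]
        (α β : ℝ) (S V : Ω → ℝ),
      0 < α → α ≤ 2 → 0 < β →
      LinnikDistribution.IsSymmetricStable α S μ →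
      HasLaw V (LinnikDistribution.genExpMeasure β) μ → IndepFun S V μ →
      (∀ t : ℝ, charFun (μ.map (LinnikDistribution.genLinnik α β S V)) t
          = ((1 / (1 + |t| ^ α) ^ (1 / β) : ℝ) : ℂ)) ∧
      (∀ s : ℂ, -(min (α / β) 1) < s.re → s.re < α →
        LinnikDistribution.HasAbsMoment (LinnikDistribution.genLinnik α β S V) μ s ∧
        LinnikDistribution.absMoment (LinnikDistribution.genLinnik α β S V) μ s =
          (2 : ℂ) ^ s * (Complex.Gamma ((s + 1) / 2) * Complex.Gamma (1 - s / α)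
              * Complex.Gamma (s / α + 1 / β))
            / ((Real.sqrt Real.pi : ℂ) * Complex.Gamma (1 / β) * Complex.Gamma (1 - s / 2))) ∧
      LinnikDistribution.rhoPlus (LinnikDistribution.genLinnik α β S V) μ
        = (if α = 2 then (⊤ : EReal) else ((α : ℝ) : EReal)) ∧
      LinnikDistribution.rhoMinus (LinnikDistribution.genLinnik α β S V) μ
        = ((-(min (α / β) 1) : ℝ) : EReal) ∧
      (∃ g : LinnikDistribution.GammaQuotient,
        LinnikDistribution.HasGammaMoments g (LinnikDistribution.genLinnik α β S V) μ
          (-(min (α / β) 1)) α ∧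
        g.gam = 2 / α ∧ g.gam' = 1 ∧ g.del = 1 / β - 1 / 2 ∧ g.kap = 0)) ∧
    -- the factorization `X_α =d X_β Y_{α,β}`, with `Y_{α,β} = L_{α/β}^{1/β}`
    (∀ (Ω : Type*) [MeasurableSpace Ω] (μ : Measure Ω) [IsProbabilityMeasure μ]
        (Ω' : Type*) [MeasurableSpace Ω'] (ν : Measure Ω') [IsProbabilityMeasure ν]
        (α β : ℝ) (S V : Ω → ℝ) (S' V' T T' : Ω' → ℝ),
      0 < α → α < β → β ≤ 2 →
      LinnikDistribution.IsSymmetricStable α S μ → HasLaw V (expMeasure 1) μ → IndepFun S V μ →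
      LinnikDistribution.IsSymmetricStable β S' ν → HasLaw V' (expMeasure 1) ν →
      IndepFun S' V' ν →
      LinnikDistribution.IsPositiveStable (α / β) T ν →
      LinnikDistribution.IsPositiveStable (α / β) T' ν → IndepFun T T' ν →
      IndepFun (LinnikDistribution.linnik β S' V')
        (fun ω => LinnikDistribution.lamperti T T' ω ^ (1 / β)) ν →
      IdentDistrib (LinnikDistribution.linnik α S V)
        (fun ω => LinnikDistribution.linnik β S' V' ω
          * LinnikDistribution.lamperti T T' ω ^ (1 / β)) μ ν) := by
  refine ⟨?_, ?_, ?_⟩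
  · intro Ω _ μ _ α S V hα hα2 hS hV hSV
    have hV1 : HasLaw V (LinnikDistribution.genExpMeasure 1) μ :=
      LinnikDistribution.expMeasure_one ▸ hV
    have hrho := LinnikDistribution.rhoMinus_genLinnik hα one_pos hS hV1 hSV
    have hmom := LinnikDistribution.hasGammaMoments_genLinnik hα hα2 one_pos hS hV1 hSV
    have hdel := LinnikDistribution.del_genLinnikQuotient (β := 1) hα.ne'
    rw [div_one] at hrho hmom
    refine ⟨LinnikDistribution.charFun_linnik hα hS hV hSV, fun s h1 h2 => ?_,
      LinnikDistribution.rhoPlus_genLinnik hα hα2 one_pos hS hV1 hSV, hrho,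
      LinnikDistribution.genLinnikQuotient α 1 hα.ne', hmom,
      LinnikDistribution.gam_genLinnikQuotient hα, LinnikDistribution.gam'_genLinnikQuotient hα.ne',
      hdel.trans (by norm_num), LinnikDistribution.kap_genLinnikQuotient hα.ne',
      LinnikDistribution.C₁_genLinnikQuotient_one hα⟩
    have h := LinnikDistribution.absMoment_genLinnik hα hα2 one_pos hS hV1 hSV
      (by rwa [div_one]) h2
    refine ⟨h.1, h.2.trans ?_⟩
    simp only [LinnikDistribution.genLinnikMoment, Complex.ofReal_one, div_one, Complex.Gamma_one,
      mul_one]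
    rw [add_comm s 1, add_comm (s / (α : ℂ)) 1]
    ring
  · intro Ω _ μ _ α β S V hα hα2 hβ hS hV hSV
    exact ⟨LinnikDistribution.charFun_genLinnik hα hβ hS hV hSV,
      fun s h1 h2 => LinnikDistribution.absMoment_genLinnik hα hα2 hβ hS hV hSV h1 h2,
      LinnikDistribution.rhoPlus_genLinnik hα hα2 hβ hS hV hSV,
      LinnikDistribution.rhoMinus_genLinnik hα hβ hS hV hSV,
      LinnikDistribution.genLinnikQuotient α β hα.ne',
      LinnikDistribution.hasGammaMoments_genLinnik hα hα2 hβ hS hV hSV,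
      LinnikDistribution.gam_genLinnikQuotient hα, LinnikDistribution.gam'_genLinnikQuotient hα.ne',
      LinnikDistribution.del_genLinnikQuotient hα.ne',
      LinnikDistribution.kap_genLinnikQuotient hα.ne'⟩
  · intro Ω _ μ _ Ω' _ ν _ α β S V S' V' T T' hα hαβ _ hS hV hSV hS' hV' hSV' hT hT' hTT' hind
    exact LinnikDistribution.identDistrib_linnik_mul_lamperti hα hαβ hS hV hSV hS' hV' hSV' hT hT'
      hTT' hind
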